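/- Let $p$ be a prime and let $G$ be a group that can be generated by five elements, is nilpotent of class at most $2$, and has exponent $p$ (i.e. $g^p=e$ for all $g\in G$; the trivial group is allowed). Call a group capable if it is isomorphic to $K/Z(K)$ for some group $K$. For groups $G_1,G_2$, a subgroup $H\le Z(G_1)$ and an injective homomorphism $\phi\colon H\to Z(G_2)$, the amalgamated direct product is $$G_1\times_\phi G_2=(G_1\times G_2)/\{(h,\phi(h)^{-1}) : h\in H\}.$$ Then $G$ is one and only one of the following: (i) nontrivial cyclic; (ii) isomorphic to an amalgamated direct product $G_1\times_\phi G_2$ of two nonabelian groups, where $H$ is a nontrivial cyclic subgroup of $[G_1,G_1]$ and $\phi(H)\le [G_2,G_2]$; (iii) capable. -/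

import Mathlib

universe u

/-- A group is capable if it is isomorphic to the central quotient `H ⧸ Z(H)` of some group. -/
def IsCapable (G : Type u) [Group G] : Prop :=
  ∃ (H : Type u) (_ : Group H), Nonempty (G ≃* H ⧸ Subgroup.center H)

/-- The data for an amalgamated direct product of `G` and `K`: a subgroup `H` of the center of `G`
and an embedding `φ` of `H` into the center of `K`. -/
structure CentralAmalgam (G K : Type u) [Group G] [Group K] where
  H : Subgroup G
  H_le_center : H ≤ Subgroup.center G
  φ : H →* K
  φ_injective : Function.Injective φ
  φ_mem_center : ∀ h : H, φ h ∈ Subgroup.center K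

namespace CentralAmalgam

/-- The subgroup `{(h, φ(h)⁻¹) | h ∈ H}` of `G × K`. -/
def kernel {G K : Type u} [Group G] [Group K] (A : CentralAmalgam G K) : Subgroup (G × K) where
  carrier := {x | ∃ h : A.H, x = ((h : G), (A.φ h)⁻¹)}
  one_mem' := ⟨1, Prod.ext (by simp) (by simp)⟩
  mul_mem' := by
    rintro _ _ ⟨a, rfl⟩ ⟨b, rfl⟩
    refine ⟨a * b, Prod.ext rfl ?_⟩
    have h := Subgroup.mem_center_iff.1 (A.φ_mem_center a) (A.φ b)
    simp only [Prod.snd_mul, map_mul]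
    rw [← mul_inv_rev, h]
  inv_mem' := by
    rintro _ ⟨a, rfl⟩
    exact ⟨a⁻¹, by simp⟩

instance kernel_normal {G K : Type u} [Group G] [Group K] (A : CentralAmalgam G K) :
    A.kernel.Normal where
  conj_mem := by
    rintro _ ⟨a, rfl⟩ ⟨g, k⟩
    refine ⟨a, Prod.ext ?_ ?_⟩
    · have h := Subgroup.mem_center_iff.1 (A.H_le_center a.2) g
      simp [h]
    · have h := Subgroup.mem_center_iff.1 (inv_mem (A.φ_mem_center a)) k
      simp [h]

/-- The amalgamated direct product `G ×_φ K`. -/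
abbrev Product {G K : Type u} [Group G] [Group K] (A : CentralAmalgam G K) : Type u :=
  (G × K) ⧸ A.kernel

end CentralAmalgam

/-- `G` is isomorphic to an amalgamated direct product `G₁ ×_φ G₂` of two nonabelian groups,
where `φ` identifies a nontrivial cyclic subgroup of `[G₁, G₁]` with a subgroup of `[G₂, G₂]`. -/
def IsNonabelianCommutatorAmalgam (G : Type u) [Group G] : Prop :=
  ∃ (G₁ G₂ : Type u) (_ : Group G₁) (_ : Group G₂) (A : CentralAmalgam G₁ G₂),
    (¬ ∀ x y : G₁, x * y = y * x) ∧ (¬ ∀ x y : G₂, x * y = y * x) ∧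
    IsCyclic A.H ∧ A.H ≠ ⊥ ∧
    A.H ≤ commutator G₁ ∧ A.φ.range ≤ commutator G₂ ∧
    Nonempty (G ≃* A.Product)

/-! Exclusivity: a group with cyclic central quotient is abelian; an amalgam as in (ii) is
nonabelian; and if such an amalgam were `K/Z(K)`, the three subgroups lemma would make lifts of the
amalgamated elements central in `K` (`IsNonabelianCommutatorAmalgam.not_isCapable`).

Existence: by a fibre product of central extensions (`isCapable_of_extensions`), a noncapable `G`
has some `g ≠ 1` with a central lift in every central extension of `G`. If `G` is not cyclic,
bilinear cocycles on the abelianization force `g ∈ [G,G]`, so `p` is odd. The Baer correspondence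
then writes `G` as `W × D` with an alternating `b : W × W → D`, where `dim W ≤ 5`. Each `T : D → W*`
satisfying the Jacobi identity yields a cocycle detecting every element of `[G,G]` on which it does
not vanish (`exists_extension_of_jacobi`). Hence every such `T` kills the vector `c` of `g`.

The rest is linear algebra. The forms `η ∘ b` with `η c = 0` have rank at most two, since two
hyperbolic planes in dimension at most five would give a `T` with `T c ≠ 0`. The structure of such
spaces of forms yields `v₁`, `v₂` with `b v₁ v₂ = c` whose brackets are all multiples of `c`
(`exists_bracket_ne_zero`), and `c` is also a sum of brackets of vectors orthogonal to both
(`exists_hyperbolic_pair`). Lifts of `v₁`, `v₂` and their centralizer generate `G` as a central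
product amalgamated along `⟨g⟩`. -/

open scoped commutatorElement

/-! ### Alternating forms: hyperbolic planes and spaces of forms of rank at most two. -/

section AlternatingForms

variable {F V C : Type*} [Field F] [AddCommGroup V] [Module F V] [AddCommGroup C] [Module F C]

theorem bilin_swap (b : V →ₗ[F] V →ₗ[F] C) (hb : ∀ v, b v v = 0) (u v : V) :
    b u v = - b v u := by
  have h := hb (u + v)
  simp only [map_add, LinearMap.add_apply, hb, zero_add, add_zero] at h
  exact eq_neg_of_add_eq_zero_right h

/-- Given a form `η ∘ b` containing two orthogonal hyperbolic planes on a space of dimension at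
most five, every functional `ω` is the leading term of a nonzero solution of the Jacobi
equation. -/
theorem exists_jacobi_of_hyperbolic [FiniteDimensional F V] (hdim : Module.finrank F V ≤ 5)
    (b : V →ₗ[F] V →ₗ[F] C) (hb : ∀ v, b v v = 0) (ω η : Module.Dual F C)
    {e₁ e₂ e₃ e₄ : V} (h12 : η (b e₁ e₂) = 1) (h34 : η (b e₃ e₄) = 1)
    (h13 : η (b e₁ e₃) = 0) (h14 : η (b e₁ e₄) = 0)
    (h23 : η (b e₂ e₃) = 0) (h24 : η (b e₂ e₄) = 0) :
    ∃ ξ ξ' : Module.Dual F V, ξ ≠ 0 ∧ ∀ u v w,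
      (ω (b u v) * ξ w - η (b u v) * ξ' w) + (ω (b v w) * ξ u - η (b v w) * ξ' u) +
        (ω (b w u) * ξ v - η (b w u) * ξ' v) = 0 := by
  have sw := bilin_swap b hb
  have h21 : η (b e₂ e₁) = -1 := by rw [sw, map_neg, h12]
  have h43 : η (b e₄ e₃) = -1 := by rw [sw, map_neg, h34]
  have h31 : η (b e₃ e₁) = 0 := by rw [sw, map_neg, h13, neg_zero]
  have h41 : η (b e₄ e₁) = 0 := by rw [sw, map_neg, h14, neg_zero]
  have h32 : η (b e₃ e₂) = 0 := by rw [sw, map_neg, h23, neg_zero]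
  have h42 : η (b e₄ e₂) = 0 := by rw [sw, map_neg, h24, neg_zero]
  -- These functionals are dual to `e₁, …, e₄`: each coordinate is read off by pairing under `η ∘ b`
  -- with the hyperbolic partner.
  let ε : Fin 4 → Module.Dual F V :=
    ![-(η ∘ₗ b e₂), η ∘ₗ b e₁, -(η ∘ₗ b e₄), η ∘ₗ b e₃]
  have hε0 : ∀ v, ε 0 v = - η (b e₂ v) := fun v => rfl
  have hε1 : ∀ v, ε 1 v = η (b e₁ v) := fun v => rfl
  have hε2 : ∀ v, ε 2 v = - η (b e₄ v) := fun v => rfl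
  have hε3 : ∀ v, ε 3 v = η (b e₃ v) := fun v => rfl
  let φ : V →ₗ[F] (Fin 4 → F) := LinearMap.pi ε
  have hφ : Function.Surjective φ := by
    intro x
    refine ⟨x 0 • e₁ + x 1 • e₂ + x 2 • e₃ + x 3 • e₄, ?_⟩
    ext i
    fin_cases i <;>
      simp [φ, LinearMap.pi_apply, hε0, hε1, hε2, hε3, hb, h12, h34, h13, h14, h23, h24, h21, h43,
        h31, h41, h32, h42]
  -- The dimension bound enters here: the radical of `η ∘ b` is spanned by one vector `r`, possibly
  -- zero.
  have hker : Module.finrank F (LinearMap.ker φ) ≤ 1 := by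
    have h1 := LinearMap.finrank_range_add_finrank_ker φ
    rw [LinearMap.range_eq_top.2 hφ, finrank_top, Module.finrank_fin_fun] at h1
    omega
  obtain ⟨⟨r, hr⟩, hr'⟩ := finrank_le_one_iff.1 hker
  have hr0 : ∀ i, ε i r = 0 := fun i => congrFun (LinearMap.mem_ker.1 hr) i
  have hdec : ∀ v, ∃ s : F, v = ε 0 v • e₁ + ε 1 v • e₂ + ε 2 v • e₃ + ε 3 v • e₄ + s • r := by
    intro v
    have : v - (ε 0 v • e₁ + ε 1 v • e₂ + ε 2 v • e₃ + ε 3 v • e₄) ∈ LinearMap.ker φ := by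
      rw [LinearMap.mem_ker]
      ext i
      fin_cases i <;>
      simp [φ, LinearMap.pi_apply, hε0, hε1, hε2, hε3, hb, h12, h34, h13, h14, h23, h24, h21, h43,
        h31, h41, h32, h42]
    obtain ⟨s, hs⟩ := hr' ⟨_, this⟩
    refine ⟨s, ?_⟩
    have hs' : s • r = v - (ε 0 v • e₁ + ε 1 v • e₂ + ε 2 v • e₃ + ε 3 v • e₄) :=
      congrArg Subtype.val hs
    rw [hs']; abel
  have h2r : η (b e₂ r) = 0 := by simpa [hε0] using hr0 0
  have h1r : η (b e₁ r) = 0 := by simpa [hε1] using hr0 1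
  have h4r : η (b e₄ r) = 0 := by simpa [hε2] using hr0 2
  have h3r : η (b e₃ r) = 0 := by simpa [hε3] using hr0 3
  -- the coefficients of `ξ`
  obtain ⟨x, hx0, k, hxk⟩ : ∃ x : Fin 4 → F, x ≠ 0 ∧ ∃ k : F,
      ![ω (b r e₁), ω (b r e₂), ω (b r e₃), ω (b r e₄)] = k • x := by
    by_cases h : ![ω (b r e₁), ω (b r e₂), ω (b r e₃), ω (b r e₄)] = 0
    · exact ⟨fun _ => 1, fun h => one_ne_zero (congrFun h 0), 0, by rw [h, zero_smul]⟩
    · exact ⟨_, h, 1, (one_smul _ _).symm⟩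
  have hx1 : ω (b r e₁) = k * x 0 := congrFun hxk 0
  have hx2 : ω (b r e₂) = k * x 1 := congrFun hxk 1
  have hx3 : ω (b r e₃) = k * x 2 := congrFun hxk 2
  have hx4 : ω (b r e₄) = k * x 3 := congrFun hxk 3
  have eω : ∀ (u v : V) (s t : F), u = ε 0 u • e₁ + ε 1 u • e₂ + ε 2 u • e₃ + ε 3 u • e₄ + s • r →
      v = ε 0 v • e₁ + ε 1 v • e₂ + ε 2 v • e₃ + ε 3 v • e₄ + t • r →
      ω (b u v) = (ε 0 u * ε 1 v - ε 1 u * ε 0 v) * ω (b e₁ e₂)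
        + (ε 0 u * ε 2 v - ε 2 u * ε 0 v) * ω (b e₁ e₃)
        + (ε 0 u * ε 3 v - ε 3 u * ε 0 v) * ω (b e₁ e₄)
        + (ε 1 u * ε 2 v - ε 2 u * ε 1 v) * ω (b e₂ e₃)
        + (ε 1 u * ε 3 v - ε 3 u * ε 1 v) * ω (b e₂ e₄)
        + (ε 2 u * ε 3 v - ε 3 u * ε 2 v) * ω (b e₃ e₄)
        + k * (s * (x 0 * ε 0 v + x 1 * ε 1 v + x 2 * ε 2 v + x 3 * ε 3 v)
          - t * (x 0 * ε 0 u + x 1 * ε 1 u + x 2 * ε 2 u + x 3 * ε 3 u)) := by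
    intro u v s t hu hv
    generalize ε 0 u = u0, ε 1 u = u1, ε 2 u = u2, ε 3 u = u3 at *
    generalize ε 0 v = v0, ε 1 v = v1, ε 2 v = v2, ε 3 v = v3 at *
    subst hu hv
    simp only [map_add, map_smul, LinearMap.add_apply, LinearMap.smul_apply, hb, smul_eq_mul,
      map_zero, hx1, hx2, hx3, hx4, sw e₁ r, sw e₂ r, sw e₃ r, sw e₄ r, sw e₂ e₁, sw e₃ e₁,
      sw e₄ e₁, sw e₃ e₂, sw e₄ e₂, sw e₄ e₃, map_neg]
    ring
  have eη : ∀ (u v : V) (s t : F), u = ε 0 u • e₁ + ε 1 u • e₂ + ε 2 u • e₃ + ε 3 u • e₄ + s • r →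
      v = ε 0 v • e₁ + ε 1 v • e₂ + ε 2 v • e₃ + ε 3 v • e₄ + t • r →
      η (b u v) = (ε 0 u * ε 1 v - ε 1 u * ε 0 v) + (ε 2 u * ε 3 v - ε 3 u * ε 2 v) := by
    intro u v s t hu hv
    generalize ε 0 u = u0, ε 1 u = u1, ε 2 u = u2, ε 3 u = u3 at *
    generalize ε 0 v = v0, ε 1 v = v1, ε 2 v = v2, ε 3 v = v3 at *
    subst hu hv
    simp only [map_add, map_smul, LinearMap.add_apply, LinearMap.smul_apply, hb, smul_eq_mul,
      map_zero, sw r e₁, sw r e₂, sw r e₃, sw r e₄, map_neg, h1r, h2r, h3r, h4r, h12, h34, h13,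
      h14, h23, h24, h21, h43, h31, h41, h32, h42]
    ring
  let o12 := ω (b e₁ e₂)
  let o13 := ω (b e₁ e₃)
  let o14 := ω (b e₁ e₄)
  let o23 := ω (b e₂ e₃)
  let o24 := ω (b e₂ e₄)
  let o34 := ω (b e₃ e₄)
  -- The goal is `ω ∧ ξ = η ∧ ξ'` as 3-forms on `V`. Components along `r` vanish because `ω(b r ·)`
  -- is a multiple of `ξ`, while `η`, `ξ` and `ξ'` kill `r`. On the span of the `eᵢ`, wedging with
  -- the nondegenerate `η` maps 1-forms bijectively to 3-forms; `ξ'` is the resulting solution.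
  refine ⟨x 0 • ε 0 + x 1 • ε 1 + x 2 • ε 2 + x 3 • ε 3,
    (o13 * x 3 - o14 * x 2 + o34 * x 0) • ε 0 + (o23 * x 3 - o24 * x 2 + o34 * x 1) • ε 1 +
    (o12 * x 2 - o13 * x 1 + o23 * x 0) • ε 2 + (o12 * x 3 - o14 * x 1 + o24 * x 0) • ε 3,
    ?_, ?_⟩
  · intro h
    apply hx0
    have g1 := LinearMap.congr_fun h e₁
    have g2 := LinearMap.congr_fun h e₂
    have g3 := LinearMap.congr_fun h e₃
    have g4 := LinearMap.congr_fun h e₄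
    simp [hε0, hε1, hε2, hε3, hb, h12, h34, h13, h14, h23, h24, h21, h43,
        h31, h41, h32, h42] at g1 g2 g3 g4
    ext i
    fin_cases i <;> assumption
  · intro u v w
    obtain ⟨s, hs⟩ := hdec u
    obtain ⟨t, ht⟩ := hdec v
    obtain ⟨q, hq⟩ := hdec w
    rw [eω u v s t hs ht, eω v w t q ht hq, eω w u q s hq hs, eη u v s t hs ht, eη v w t q ht hq,
      eη w u q s hq hs]
    simp only [LinearMap.add_apply, LinearMap.smul_apply, smul_eq_mul, o12, o13, o14, o23, o24,
      o34]
    ring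

/-- The alternating form `a ∧ u`. -/
def wedge (a : Module.Dual F V) : Module.Dual F V →ₗ[F] V →ₗ[F] V →ₗ[F] F where
  toFun u := LinearMap.smulRight a u - LinearMap.smulRight u a
  map_add' x y := by ext; simp; ring
  map_smul' k x := by ext; simp; ring

@[simp] theorem wedge_apply (a u : Module.Dual F V) (s t : V) :
    wedge a u s t = a s * u t - u s * a t := by simp [wedge]

end AlternatingForms

section AlternatingForms

variable {F V C : Type*} [Field F] [AddCommGroup V] [Module F V] [AddCommGroup C] [Module F C]

/-- The elements `x` with `a ∧ x ∈ Y`. -/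
def wedgeComap (Y : Submodule F (V →ₗ[F] V →ₗ[F] F)) (a : Module.Dual F V) :
    Submodule F (Module.Dual F V) := Y.comap (wedge a)

theorem self_mem_wedgeComap (Y : Submodule F (V →ₗ[F] V →ₗ[F] F)) (a : Module.Dual F V) :
    a ∈ wedgeComap Y a := by
  have : wedge a a = 0 := by ext; simp
  simp [wedgeComap, this]

theorem mem_wedgeComap_comm {Y : Submodule F (V →ₗ[F] V →ₗ[F] F)} {a u : Module.Dual F V}
    (h : u ∈ wedgeComap Y a) : a ∈ wedgeComap Y u := by
  have : wedge u a = (-1 : F) • wedge a u := by ext; simp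
  rw [wedgeComap, Submodule.mem_comap, this]
  exact Y.smul_mem _ h

/-- All forms in `Y` are alternating of rank at most two. -/
structure RankLeTwo (Y : Submodule F (V →ₗ[F] V →ₗ[F] F)) : Prop where
  alt : ∀ η ∈ Y, ∀ v, η v v = 0
  decomp : ∀ η ∈ Y, ∀ e₁ e₂, η e₁ e₂ = 1 → ∀ u v, η u v = η e₁ u * η e₂ v - η e₁ v * η e₂ u

variable {Y : Submodule F (V →ₗ[F] V →ₗ[F] F)}

theorem RankLeTwo.eq_wedge (hY : RankLeTwo Y) {η : V →ₗ[F] V →ₗ[F] F} (hη : η ∈ Y) {v w : V}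
    (hvw : η v w = 1) : η = wedge (η v) (η w) := by
  ext s t
  rw [wedge_apply, hY.decomp η hη v w hvw s t]
  ring

/-- Here `η = η v ∧ η w`. If `a` were a multiple of `η v`, then `η w` would lie in `wedgeComap Y a`
without vanishing at `v`. For `u` in `wedgeComap Y a`, the form `η + a ∧ u` again has rank at most
two; expanding it along `v, w` makes `a - a(w) η v` and `u - u(w) η v` proportional. -/
theorem RankLeTwo.wedgeComap_le (hY : RankLeTwo Y) {a : Module.Dual F V} (ha : a ≠ 0)
    {η : V →ₗ[F] V →ₗ[F] F} (hη : η ∈ Y) {v w : V} (hvw : η v w = 1)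
    (hv : ∀ u ∈ wedgeComap Y a, u v = 0) :
    a ∉ Submodule.span F {η v} ∧ wedgeComap Y a ≤ Submodule.span F {a, η v} := by
  have hav : a v = 0 := hv a (self_mem_wedgeComap Y a)
  have hwv : η w v = -1 := by rw [bilin_swap η (hY.alt η hη), hvw]
  have key : a ∉ Submodule.span F {η v} := by
    intro h
    obtain ⟨k, rfl⟩ := Submodule.mem_span_singleton.1 h
    have h1 : η w ∈ wedgeComap Y (k • η v) := by
      have : wedge (k • η v) (η w) = k • η := by
        conv_rhs => rw [hY.eq_wedge hη hvw]
        ext; simp; ring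
      simpa [wedgeComap, this] using Y.smul_mem k hη
    have := hv _ h1
    rw [hwv] at this
    simp at this
  refine ⟨key, fun u hu => ?_⟩
  have huv := hv u hu
  have hsum : η + wedge a u ∈ Y := Y.add_mem hη hu
  have h1 : (η + wedge a u) v w = 1 := by simp [hvw, hav, huv]
  have h2 := hY.decomp _ hsum v w h1
  have h3 := hY.decomp _ hη v w hvw
  have h4 : ∀ s t, (a - a w • η v) s * (u - u w • η v) t = (u - u w • η v) s * (a - a w • η v) t := by
    intro s t
    have h2' := h2 s t
    rw [LinearMap.add_apply, LinearMap.add_apply, h3 s t] at h2'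
    simp only [LinearMap.add_apply, wedge_apply, hav, huv, LinearMap.sub_apply,
      LinearMap.smul_apply, smul_eq_mul] at h2' ⊢
    linear_combination h2'
  have h5 : a - a w • η v ≠ 0 := by
    intro h
    exact key (Submodule.mem_span_singleton.2 ⟨a w, (sub_eq_zero.1 h).symm⟩)
  obtain ⟨s, hs⟩ : ∃ s, (a - a w • η v) s ≠ 0 := by
    by_contra! h
    exact h5 (LinearMap.ext h)
  rw [Submodule.mem_span_pair]
  set κ := (u - u w • η v) s / (a - a w • η v) s
  refine ⟨κ, u w - κ * a w, ?_⟩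
  ext t
  have h6 := h4 s t
  have h7 : κ * (a - a w • η v) s = (u - u w • η v) s := div_mul_cancel₀ _ hs
  rw [← h7] at h6
  have h8 : (u - u w • η v) t = κ * (a - a w • η v) t := by
    apply mul_left_cancel₀ hs
    linear_combination h6
  simp only [LinearMap.sub_apply, LinearMap.smul_apply, smul_eq_mul, LinearMap.add_apply] at h8 ⊢
  linear_combination -h8

/-- A nonzero space of alternating forms of rank at most two contains, for a suitable `a ≠ 0`,
enough forms `a ∧ x` to cut out its radical. -/
theorem RankLeTwo.exists_wedge (hY : RankLeTwo Y) (hne : Y ≠ ⊥) :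
    ∃ a : Module.Dual F V, a ≠ 0 ∧
      ∀ v, (∀ u ∈ wedgeComap Y a, u v = 0) → ∀ η ∈ Y, η v = 0 := by
  obtain ⟨θ, hθ, hθ0⟩ := Submodule.exists_mem_ne_zero_of_ne_bot hne
  have norm : ∀ η ∈ Y, ∀ v, η v ≠ 0 → ∃ w, η v w = 1 := by
    intro η _ v h
    obtain ⟨w, hw⟩ : ∃ w, η v w ≠ 0 := by
      by_contra! h'
      exact h (LinearMap.ext h')
    exact ⟨(η v w)⁻¹ • w, by simp [hw]⟩
  obtain ⟨p, hp⟩ : ∃ p, θ p ≠ 0 := by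
    by_contra! h'
    exact hθ0 (LinearMap.ext h')
  obtain ⟨q, hq⟩ := norm θ hθ p hp
  -- If `a = θ p` fails at `v`, the previous lemma confines `wedgeComap Y (θ p)` to the span of `θ
  -- p` and `η v`. As `θ q` lies in it, so does `η v`, and by symmetry `wedgeComap Y (η v)` contains
  -- the independent functionals `η v`, `θ p`, `η w`. If `a = η v` fails as well, that space lies in
  -- a span of two vectors.
  by_contra! hcon
  obtain ⟨v, hv, η, hη, hηv⟩ := hcon (θ p) hp
  obtain ⟨w, hw⟩ := norm η hη v hηv
  obtain ⟨hni, hle⟩ := hY.wedgeComap_le hp hη hw hv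
  have hqm : θ q ∈ wedgeComap Y (θ p) := by
    change wedge (θ p) (θ q) ∈ Y
    rwa [← hY.eq_wedge hθ hq]
  have hpp : θ p p = 0 := hY.alt θ hθ p
  have hqp : θ q p = -1 := by rw [bilin_swap θ (hY.alt θ hθ), hq]
  obtain ⟨α, ζ, hαζ⟩ := Submodule.mem_span_pair.1 (hle hqm)
  have hζ : ζ ≠ 0 := by
    rintro rfl
    have := LinearMap.congr_fun hαζ p
    simp [hpp, hqp] at this
  have hz : η v ∈ wedgeComap Y (θ p) := by
    have : η v = ζ⁻¹ • (θ q - α • θ p) := by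
      rw [← hαζ, add_sub_cancel_left, inv_smul_smul₀ hζ]
    rw [this]
    exact Submodule.smul_mem _ _ (Submodule.sub_mem _ hqm
      (Submodule.smul_mem _ _ (self_mem_wedgeComap Y _)))
  have ha : θ p ∈ wedgeComap Y (η v) := mem_wedgeComap_comm hz
  have hy : η w ∈ wedgeComap Y (η v) := by
    change wedge (η v) (η w) ∈ Y
    rwa [← hY.eq_wedge hη hw]
  have hwv : η w v = -1 := by rw [bilin_swap η (hY.alt η hη), hw]
  have hvv : η v v = 0 := hY.alt η hη v
  have hpv : θ p v = 0 := hv _ (self_mem_wedgeComap Y _)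
  obtain ⟨v', hv', η', hη', hηv'⟩ := hcon (η v) hηv
  obtain ⟨w', hw'⟩ := norm η' hη' v' hηv'
  obtain ⟨-, hle'⟩ := hY.wedgeComap_le hηv hη' hw' hv'
  have hli : LinearIndependent F ![η v, θ p, η w] := by
    rw [Fintype.linearIndependent_iff]
    intro g hg
    simp only [Fin.sum_univ_three, Matrix.cons_val_zero, Matrix.cons_val_one,
      Matrix.cons_val_two] at hg
    have g2 : g 2 = 0 := by simpa [hvv, hpv, hwv] using LinearMap.congr_fun hg v
    rw [g2, zero_smul, add_zero] at hg
    have g1 : g 1 = 0 := by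
      by_contra h
      refine hni (Submodule.mem_span_singleton.2 ⟨-(g 1)⁻¹ * g 0, ?_⟩)
      rw [mul_smul, eq_neg_of_add_eq_zero_left hg, smul_neg, neg_smul, neg_neg,
        inv_smul_smul₀ h]
    rw [g1, zero_smul, add_zero] at hg
    have g0 : g 0 = 0 := (smul_eq_zero.1 hg).resolve_right hηv
    intro i
    fin_cases i <;> assumption
  have hcard : 3 ≤ Module.finrank F (Submodule.span F {η v, η' v'}) := by
    have hsub : Submodule.span F (Set.range ![η v, θ p, η w]) ≤ Submodule.span F {η v, η' v'} := by
      rw [Submodule.span_le]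
      rintro _ ⟨i, rfl⟩
      fin_cases i
      · exact Submodule.subset_span (by simp)
      · exact hle' ha
      · exact hle' hy
    have h3 := finrank_span_eq_card hli
    have : FiniteDimensional F (Submodule.span F {η v, η' v'}) :=
      FiniteDimensional.span_of_finite F (by simp)
    exact h3.symm.le.trans (Submodule.finrank_mono hsub)
  classical
  have hcard2 : Module.finrank F (Submodule.span F {η v, η' v'}) ≤ 2 := by
    have := finrank_span_finset_le_card (R := F) ({η v, η' v'} : Finset (Module.Dual F V))
    refine le_trans ?_ (this.trans Finset.card_le_two)
    rw [Set.finrank, Finset.coe_pair]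
  omega

end AlternatingForms

/-! ### Vectors killed by every solution of the Jacobi identity. -/

section Jacobi

variable {F V C : Type*} [Field F] [AddCommGroup V] [Module F V] [AddCommGroup C] [Module F C]

/-- `T` satisfies the Jacobi identity relative to the bracket `b`. -/
def IsJacobi (b : V →ₗ[F] V →ₗ[F] C) (T : C →ₗ[F] V →ₗ[F] F) : Prop :=
  ∀ u v w, T (b u v) w + T (b v w) u + T (b w u) v = 0

/-- The form `η ∘ b` attached to a functional `η`. -/
def formMap (b : V →ₗ[F] V →ₗ[F] C) : Module.Dual F C →ₗ[F] V →ₗ[F] V →ₗ[F] F where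
  toFun η := b.compr₂ η
  map_add' _ _ := by ext; simp
  map_smul' _ _ := by ext; simp

@[simp] theorem formMap_apply (b : V →ₗ[F] V →ₗ[F] C) (η : Module.Dual F C) (u v : V) :
    formMap b η u v = η (b u v) := rfl

/-- The forms `η ∘ b` with `η c = 0`. -/
def formsVanishing (b : V →ₗ[F] V →ₗ[F] C) (c : C) : Submodule F (V →ₗ[F] V →ₗ[F] F) :=
  (LinearMap.ker (Module.Dual.eval F C c)).map (formMap b)

theorem mem_formsVanishing {b : V →ₗ[F] V →ₗ[F] C} {c : C} {θ : V →ₗ[F] V →ₗ[F] F} :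
    θ ∈ formsVanishing b c ↔ ∃ η : Module.Dual F C, η c = 0 ∧ formMap b η = θ := by
  simp [formsVanishing]

theorem exists_dual_eq_one {c : C} {D : Submodule F C} (hc : c ∉ D) :
    ∃ ω : Module.Dual F C, ω c = 1 ∧ ∀ d ∈ D, ω d = 0 := by
  obtain ⟨f, hf, hD⟩ := Submodule.exists_le_ker_of_notMem hc
  exact ⟨(f c)⁻¹ • f, by simp [hf], fun d hd => by simp [LinearMap.mem_ker.1 (hD hd)]⟩

theorem forall_mem_span_of_formsVanishing {b : V →ₗ[F] V →ₗ[F] C} {c : C} {v : V}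
    (h : ∀ θ ∈ formsVanishing b c, θ v = 0) (u : V) : b v u ∈ Submodule.span F {c} := by
  by_contra hn
  obtain ⟨η, h1, h2⟩ := exists_dual_eq_one hn
  have := LinearMap.congr_fun (h _ (mem_formsVanishing.2
    ⟨η, h2 c (Submodule.mem_span_singleton_self c), rfl⟩)) u
  simp [h1] at this

/-- A failure of decomposability, measured by `δ`, means that the projections of `u` and `v`
orthogonal to `e₁, e₂` pair nontrivially. After scaling by `δ⁻¹` they form a second hyperbolic
plane, and the solution `ω ⊗ ξ - η ⊗ ξ'` takes the value `ξ ≠ 0` at `c`. -/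
theorem rankLeTwo_formsVanishing [FiniteDimensional F V] (hdim : Module.finrank F V ≤ 5)
    (b : V →ₗ[F] V →ₗ[F] C) (hb : ∀ v, b v v = 0) {c : C} (hc : c ≠ 0)
    (hbad : ∀ T, IsJacobi b T → T c = 0) : RankLeTwo (formsVanishing b c) where
  alt := by
    intro θ hθ v
    obtain ⟨η, -, rfl⟩ := mem_formsVanishing.1 hθ
    simp [hb]
  decomp := by
    intro θ hθ e₁ e₂ h12 u v
    obtain ⟨η, hη, rfl⟩ := mem_formsVanishing.1 hθ
    obtain ⟨ω, hω, -⟩ := exists_dual_eq_one (F := F) (D := ⊥) (by simpa using hc)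
    simp only [formMap_apply] at h12 ⊢
    by_contra hne
    have sw := bilin_swap b hb
    have h21 : η (b e₂ e₁) = -1 := by rw [sw, map_neg, h12]
    set δ := η (b u v) - (η (b e₁ u) * η (b e₂ v) - η (b e₁ v) * η (b e₂ u)) with hδ
    have hδ0 : δ ≠ 0 := sub_ne_zero.2 hne
    obtain ⟨ξ, ξ', hξ, hJ⟩ := exists_jacobi_of_hyperbolic hdim b hb ω η (e₁ := e₁) (e₂ := e₂)
      (e₃ := u + η (b e₂ u) • e₁ - η (b e₁ u) • e₂)
      (e₄ := δ⁻¹ • (v + η (b e₂ v) • e₁ - η (b e₁ v) • e₂)) h12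
      (by
        simp only [map_add, map_sub, map_smul, LinearMap.add_apply, LinearMap.sub_apply,
          LinearMap.smul_apply, smul_eq_mul, hb, h12, h21, map_zero, sw u e₁, sw u e₂, map_neg]
        rw [inv_mul_eq_one₀ hδ0, hδ]
        ring)
      (by simp [hb, h12]) (by simp [hb, h12]) (by simp [hb, h21]) (by simp [hb, h21])
    have := hbad (ω.smulRight ξ - η.smulRight ξ') (fun u v w => by simpa using hJ u v w)
    simp [hω, hη, hξ] at this

/-- If `c` is annihilated by every solution of the Jacobi identity, the space of vectors whose
brackets are multiples of `c` is not isotropic. -/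
theorem exists_bracket_ne_zero [FiniteDimensional F V] (h2 : (2 : F) ≠ 0)
    (hdim : Module.finrank F V ≤ 5)
    (b : V →ₗ[F] V →ₗ[F] C) (hb : ∀ v, b v v = 0) {c : C} (hc : c ≠ 0)
    (hspan : c ∈ Submodule.span F {d | ∃ u v, b u v = d})
    (hbad : ∀ T, IsJacobi b T → T c = 0) :
    ∃ v₁ v₂, b v₁ v₂ ≠ 0 ∧ (∀ u, b v₁ u ∈ Submodule.span F {c}) ∧
      ∀ u, b v₂ u ∈ Submodule.span F {c} := by
  set R : Submodule F V := LinearMap.ker (b.compr₂ (Submodule.span F {c}).mkQ) with hR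
  have memR : ∀ v, v ∈ R ↔ ∀ u, b v u ∈ Submodule.span F {c} := by
    intro v
    rw [hR, LinearMap.mem_ker, LinearMap.ext_iff]
    simp
  by_contra! hcon
  have hiso : ∀ u ∈ R, ∀ v ∈ R, b u v = 0 := by
    intro u hu v hv
    by_contra hne
    obtain ⟨w, hw⟩ := hcon u v hne ((memR u).1 hu)
    exact hw ((memR v).1 hv w)
  have hY := rankLeTwo_formsVanishing hdim b hb hc hbad
  have hYne : formsVanishing b c ≠ ⊥ := by
    intro h
    have hRtop : ∀ v, v ∈ R := fun v => (memR v).2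
      (forall_mem_span_of_formsVanishing (by simp [h]))
    apply hc
    have : Submodule.span F {d | ∃ u v, b u v = d} ≤ ⊥ := by
      rw [Submodule.span_le]
      rintro _ ⟨u, v, rfl⟩
      exact hiso u (hRtop u) v (hRtop v)
    simpa using this hspan
  obtain ⟨a, ha, hcut⟩ := hY.exists_wedge hYne
  -- Double annihilator: the common zeros of `wedgeComap` lie in `R`, so every functional vanishing
  -- on `R` belongs to it.
  have hann : ∀ x : Module.Dual F V, (∀ v ∈ R, x v = 0) → x ∈ wedgeComap (formsVanishing b c) a := by
    intro x hx
    rw [← Subspace.dualCoannihilator_dualAnnihilator_eq (W := wedgeComap (formsVanishing b c) a),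
      Submodule.mem_dualAnnihilator]
    intro v hv
    exact hx v ((memR v).2 (forall_mem_span_of_formsVanishing
      (hcut v ((Submodule.mem_dualCoannihilator v).1 hv))))
  obtain ⟨R', hR'⟩ := R.exists_isCompl
  let π : V →ₗ[F] V := R'.subtype ∘ₗ Submodule.projectionOnto R' R hR'.symm
  have hπR : ∀ v ∈ R, π v = 0 := by
    intro v hv
    simp only [π, LinearMap.comp_apply]
    rw [(Submodule.projectionOnto_apply_eq_zero_iff hR'.symm).2 hv]
    simp
  have hπ : ∀ v, v - π v ∈ R := by
    intro v
    rw [← Submodule.projectionOnto_apply_eq_zero_iff hR'.symm, map_sub, sub_eq_zero]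
    exact (Submodule.projectionOnto_apply_left hR'.symm _).symm
  obtain ⟨ω, hω, -⟩ := exists_dual_eq_one (F := F) (D := ⊥) (by simpa using hc)
  let B := formMap b ω
  -- This `x` vanishes on `R` in its second argument, so `a ∧ x w` has the form `S w ∘ b` with `S w
  -- c = 0`. Its antisymmetrization is `B`, because `B` vanishes on pairs from `R`. These two facts
  -- make `ω ⊗ a` plus the flip of `S` a Jacobi solution with value `a ≠ 0` at `c`.
  let x : V →ₗ[F] V →ₗ[F] F := B.compl₂ π - (2⁻¹ : F) • B.compl₁₂ π π
  have hx : ∀ w v, x w v = ω (b w (π v)) - 2⁻¹ * ω (b (π w) (π v)) := fun w v => rfl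
  have hxa : ∀ w, wedge a (x w) ∈ formsVanishing b c := by
    intro w
    apply hann
    intro v hv
    rw [hx, hπR v hv]
    simp
  -- The pointwise choice need not be linear in `w`; it is made on a basis and extended linearly to
  -- `S`.
  choose σ hσc hσ using fun w => mem_formsVanishing.1 (hxa w)
  let β := Module.finBasis F V
  let S : V →ₗ[F] Module.Dual F C := β.constr F fun i => σ (β i)
  have hSc : ∀ w, S w c = 0 := by
    have : Module.Dual.eval F C c ∘ₗ S = 0 := β.ext fun i => by simp [S, hσc]
    exact fun w => LinearMap.congr_fun this w
  have hSb : ∀ u v w, S w (b u v) = a u * x w v - x w u * a v := by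
    have : formMap b ∘ₗ S = wedge a ∘ₗ x := β.ext fun i => by simp [S, hσ]
    intro u v w
    rw [← wedge_apply, ← formMap_apply]
    exact congrArg (fun θ : V →ₗ[F] V →ₗ[F] F => θ u v) (LinearMap.congr_fun this w)
  have hxx : ∀ w v, x w v - x v w = ω (b w v) := by
    intro w v
    have h1 := hiso _ (hπ w) _ (hπ v)
    have h3 := congrArg ω h1
    simp only [map_sub, LinearMap.sub_apply, map_zero] at h3
    rw [hx, hx]
    have sw := bilin_swap b hb
    rw [sw v (π w), sw (π v) (π w), map_neg, map_neg]
    field_simp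
    linear_combination -2 * h3
  have := hbad (ω.smulRight a + S.flip) (by
    intro u v w
    simp only [LinearMap.add_apply, LinearMap.smulRight_apply, LinearMap.flip_apply,
      LinearMap.smul_apply, smul_eq_mul, hSb]
    have h1 := hxx w v
    have h3 := hxx u w
    have h4 := hxx v u
    have sw := bilin_swap b hb
    rw [sw w v, map_neg] at h1
    rw [sw u w, map_neg] at h3
    rw [sw v u, map_neg] at h4
    linear_combination a u * h1 + a v * h3 + a w * h4)
  apply ha
  ext v
  have h3 := LinearMap.congr_fun this v
  simpa [hω, hSc] using h3

/-- If `c` were outside the span of brackets of the vectors orthogonal to the pair, some `ω` with `ω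
c = 1` would vanish on that span. Projecting orthogonally to the pair makes `ω ∘ b` the wedge of `ω
∘ b v₁` and `ω ∘ b v₃`, so `ω ⊗ (ω ∘ b v₁)` satisfies Jacobi and does not kill `c`. -/
theorem exists_hyperbolic_pair [FiniteDimensional F V] (h2 : (2 : F) ≠ 0)
    (hdim : Module.finrank F V ≤ 5)
    (b : V →ₗ[F] V →ₗ[F] C) (hb : ∀ v, b v v = 0) {c : C} (hc : c ≠ 0)
    (hspan : c ∈ Submodule.span F {d | ∃ u v, b u v = d})
    (hbad : ∀ T, IsJacobi b T → T c = 0) :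
    ∃ v₁ v₂, b v₁ v₂ = c ∧ (∀ u, b v₁ u ∈ Submodule.span F {c}) ∧
      (∀ u, b v₂ u ∈ Submodule.span F {c}) ∧
      c ∈ Submodule.span F {d | ∃ u v, b v₁ u = 0 ∧ b v₂ u = 0 ∧ b v₁ v = 0 ∧ b v₂ v = 0 ∧
        b u v = d} := by
  obtain ⟨v₁, v₂, hne, h₁, h₂⟩ := exists_bracket_ne_zero h2 hdim b hb hc hspan hbad
  obtain ⟨k, hk⟩ := Submodule.mem_span_singleton.1 (h₁ v₂)
  have hk0 : k ≠ 0 := by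
    rintro rfl
    exact hne (by rw [← hk, zero_smul])
  obtain ⟨v₃, rfl⟩ : ∃ v₃, v₂ = k • v₃ := ⟨k⁻¹ • v₂, by rw [smul_inv_smul₀ hk0]⟩
  have h12 : b v₁ v₃ = c := by
    rw [map_smul] at hk
    exact (smul_right_injective C hk0 hk).symm
  have h₃ : ∀ u, b v₃ u ∈ Submodule.span F {c} := by
    intro u
    have := h₂ u
    rwa [map_smul, LinearMap.smul_apply, Submodule.smul_mem_iff _ hk0] at this
  have sw := bilin_swap b hb
  refine ⟨v₁, v₃, h12, h₁, h₃, ?_⟩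
  by_contra hn
  obtain ⟨ω, hω, hω0⟩ := exists_dual_eq_one hn
  have hs : ∀ u, b v₁ u = ω (b v₁ u) • c := by
    intro u
    obtain ⟨t, ht⟩ := Submodule.mem_span_singleton.1 (h₁ u)
    rw [← ht, map_smul, hω, smul_eq_mul, mul_one]
  have ht : ∀ u, b v₃ u = ω (b v₃ u) • c := by
    intro u
    obtain ⟨t, ht⟩ := Submodule.mem_span_singleton.1 (h₃ u)
    rw [← ht, map_smul, hω, smul_eq_mul, mul_one]
  have h31 : b v₃ v₁ = -c := by rw [sw, h12]
  have key : ∀ u v, ω (b u v) = ω (b v₁ u) * ω (b v₃ v) - ω (b v₁ v) * ω (b v₃ u) := by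
    intro u v
    have perp1 : ∀ u, b v₁ (u + ω (b v₃ u) • v₁ - ω (b v₁ u) • v₃) = 0 := by
      intro u
      simp only [map_add, map_sub, map_smul, hb, h12, smul_zero, add_zero]
      rw [← hs, sub_self]
    have perp3 : ∀ u, b v₃ (u + ω (b v₃ u) • v₁ - ω (b v₁ u) • v₃) = 0 := by
      intro u
      simp only [map_add, map_sub, map_smul, hb, h31, smul_zero, sub_zero, smul_neg]
      rw [← ht, add_neg_cancel]
    have h0 := hω0 _ (Submodule.subset_span ⟨_, _, perp1 u, perp3 u, perp1 v, perp3 v, rfl⟩)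
    simp only [map_add, map_sub, map_smul, LinearMap.add_apply, LinearMap.sub_apply,
      LinearMap.smul_apply, smul_eq_mul, hb, h12, h31, map_zero, sw u v₁, sw u v₃, map_neg, hω]
      at h0
    linear_combination h0
  have := hbad (ω.smulRight (ω ∘ₗ b v₁)) (by
    intro u v w
    simp only [LinearMap.smulRight_apply, LinearMap.smul_apply, LinearMap.comp_apply, smul_eq_mul]
    rw [key u v, key v w, key w u]
    ring)
  have h3 := LinearMap.congr_fun this v₃
  simp [hω, h12] at h3

end Jacobi

/-! ### Capability through central extensions and cocycles. -/

section Capability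

/-- A group is capable as soon as every nontrivial element is detected by a central extension. -/
theorem isCapable_of_extensions {G : Type u} [Group G]
    (h : ∀ g : G, g ≠ 1 → ∃ (E : Type u) (_ : Group E) (f : E →* G), Function.Surjective f ∧
      f.ker ≤ Subgroup.center E ∧ ∀ x, f x = g → x ∉ Subgroup.center E) : IsCapable G := by
  classical
  choose E instE f hsurj hker hne using fun i : {g : G // g ≠ 1} => h i.1 i.2
  -- The fibre product over `G` of the chosen extensions; its centre turns out to be exactly the
  -- kernel of the projection to `G`.
  let P : Subgroup (G × (∀ i, E i)) :=
    { carrier := {x | ∀ i, f i (x.2 i) = x.1}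
      one_mem' := by intro i; simp
      mul_mem' := by intro x y hx hy i; simp [hx i, hy i]
      inv_mem' := by intro x hx i; simp [hx i] }
  let q : P →* G := (MonoidHom.fst _ _).comp P.subtype
  have hq : Function.Surjective q := by
    intro g
    choose s hs using fun i => hsurj i g
    exact ⟨⟨(g, s), hs⟩, rfl⟩
  have hcen : q.ker = Subgroup.center P := by
    apply le_antisymm
    · rintro ⟨⟨x, s⟩, hx⟩ (hk : x = 1)
      subst hk
      rw [Subgroup.mem_center_iff]
      rintro ⟨⟨y, t⟩, hy⟩
      refine Subtype.ext (Prod.ext (by simp) (funext fun i => ?_))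
      exact Subgroup.mem_center_iff.1 (hker i (hx i)) (t i)
    · rintro ⟨⟨x, s⟩, hx⟩ hc
      by_contra hx1
      replace hx1 : x ≠ 1 := hx1
      refine hne ⟨x, hx1⟩ (s ⟨x, hx1⟩) (hx _) (Subgroup.mem_center_iff.2 fun e => ?_)
      choose t ht using fun i => hsurj i (f ⟨x, hx1⟩ e)
      -- Every `e` in the factor indexed by `x` extends to an element of `P`, so a central element
      -- of `P` above `x` has a central coordinate there, contrary to the choice of that factor.
      have hmem : ((f ⟨x, hx1⟩ e, Function.update t ⟨x, hx1⟩ e) : G × ∀ i, E i) ∈ P := by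
        intro i
        by_cases hi : i = ⟨x, hx1⟩
        · subst hi; simp
        · simp [Function.update_of_ne hi, ht]
      have := congrArg (fun z : P => z.1.2 ⟨x, hx1⟩) (Subgroup.mem_center_iff.1 hc ⟨_, hmem⟩)
      simpa using this
  exact ⟨P, inferInstance, ⟨((QuotientGroup.quotientMulEquivOfEq hcen).symm.trans
    (QuotientGroup.quotientKerEquivOfSurjective q hq)).symm⟩⟩

/-- The underlying set of the extension defined by a cocycle. -/
@[ext] structure TwistedProd (G : Type*) (A : Type*) where
  fst : G
  snd : A

/-- The extension of `G` by `A` defined by a normalized cocycle. -/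
@[reducible] def TwistedProd.group {G A : Type*} [Group G] [AddCommGroup A] (f : G → G → A)
    (h1 : ∀ g, f 1 g = 0) (hf : ∀ g h k, f g h + f (g * h) k = f h k + f g (h * k)) :
    Group (TwistedProd G A) :=
  letI : Mul (TwistedProd G A) := ⟨fun x y => ⟨x.1 * y.1, x.2 + y.2 + f x.1 y.1⟩⟩
  letI : One (TwistedProd G A) := ⟨⟨1, 0⟩⟩
  letI : Inv (TwistedProd G A) := ⟨fun x => ⟨x.1⁻¹, -x.2 - f x.1⁻¹ x.1⟩⟩
  Group.ofLeftAxioms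
    (fun x y z => TwistedProd.ext (mul_assoc _ _ _) (by
      change x.2 + y.2 + f x.1 y.1 + z.2 + f (x.1 * y.1) z.1 =
        x.2 + (y.2 + z.2 + f y.1 z.1) + f x.1 (y.1 * z.1)
      rw [add_assoc (x.2 + y.2), add_comm (f x.1 y.1), ← add_assoc, add_assoc, hf]
      abel))
    (fun x => TwistedProd.ext (one_mul _) (by
      change 0 + x.2 + f 1 x.1 = x.2
      rw [h1, zero_add, add_zero]))
    (fun x => TwistedProd.ext (inv_mul_cancel _) (by
      change -x.2 - f x.1⁻¹ x.1 + x.2 + f x.1⁻¹ x.1 = 0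
      abel))

theorem exists_extension_of_cocycle {G : Type u} [Group G] {A : Type} [AddCommGroup A]
    (f : G → G → A) (h1 : ∀ g, f 1 g = 0)
    (hf : ∀ g h k, f g h + f (g * h) k = f h k + f g (h * k)) {g h : G}
    (hne : g * h = h * g → f g h ≠ f h g) :
    ∃ (E : Type u) (_ : Group E) (π : E →* G), Function.Surjective π ∧
      π.ker ≤ Subgroup.center E ∧ ∀ x, π x = g → x ∉ Subgroup.center E := by
  have h1' : ∀ g, f g 1 = 0 := by
    intro g
    have := hf g 1 1
    rw [mul_one, mul_one, add_left_inj, h1] at this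
    exact this
  let := TwistedProd.group f h1 hf
  have hmul : ∀ x y : TwistedProd G A, x * y = ⟨x.1 * y.1, x.2 + y.2 + f x.1 y.1⟩ :=
    fun _ _ => rfl
  let π : TwistedProd G A →* G := MonoidHom.mk' TwistedProd.fst (fun _ _ => rfl)
  refine ⟨TwistedProd G A, inferInstance, π, fun g => ⟨⟨g, 0⟩, rfl⟩, ?_, ?_⟩
  · rintro ⟨x, a⟩ (hx : x = 1)
    subst hx
    rw [Subgroup.mem_center_iff]
    rintro ⟨y, b⟩
    simp only [hmul, h1, h1', mul_one, one_mul, add_comm]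
  · rintro ⟨x, a⟩ (hx : x = g) hc
    subst hx
    have := Subgroup.mem_center_iff.1 hc ⟨h, 0⟩
    simp only [hmul, TwistedProd.mk.injEq, zero_add, add_zero] at this
    exact hne this.1.symm (add_left_cancel this.2).symm

theorem not_isCapable_of_isCyclic {G : Type u} [Group G] [IsCyclic G] [Nontrivial G] :
    ¬ IsCapable G := by
  rintro ⟨K, _, ⟨e⟩⟩
  have : IsCyclic (K ⧸ Subgroup.center K) := isCyclic_of_surjective e e.surjective
  have hcomm := MonoidHom.isMulCommutative_of_isCyclic_of_ker_le_center
    (QuotientGroup.mk' (Subgroup.center K)) (by rw [QuotientGroup.ker_mk'])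
  have htop : Subgroup.center K = ⊤ := by
    rw [eq_top_iff]
    intro x _
    exact Subgroup.mem_center_iff.2 fun y => mul_comm' y x
  obtain ⟨g, hg⟩ := exists_ne (1 : G)
  apply hg
  apply e.injective
  obtain ⟨k, hk⟩ := QuotientGroup.mk_surjective (e g)
  rw [map_one, ← hk, QuotientGroup.eq_one_iff, htop]
  trivial

end Capability

/-! ### Amalgamated products and why they are not capable. -/

namespace CentralAmalgam

variable {G₁ G₂ : Type u} [Group G₁] [Group G₂] (A : CentralAmalgam G₁ G₂)

/-- The inclusion of the first factor. -/
def inl : G₁ →* A.Product := (QuotientGroup.mk' A.kernel).comp (MonoidHom.inl G₁ G₂)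

/-- The inclusion of the second factor. -/
def inr : G₂ →* A.Product := (QuotientGroup.mk' A.kernel).comp (MonoidHom.inr G₁ G₂)

theorem inl_injective : Function.Injective A.inl := by
  rw [injective_iff_map_eq_one]
  intro g hg
  obtain ⟨h, hh⟩ := (QuotientGroup.eq_one_iff _).1 hg
  obtain ⟨h1, h2⟩ := Prod.ext_iff.1 hh
  have : A.φ h = 1 := by simpa using h2.symm
  rw [(injective_iff_map_eq_one _).1 A.φ_injective h this] at h1
  simpa using h1

theorem inl_eq_inr (h : A.H) : A.inl h = A.inr (A.φ h) := by
  refine QuotientGroup.eq.2 ⟨h⁻¹, ?_⟩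
  ext <;> simp

theorem commute_inl_inr (x : G₁) (y : G₂) : Commute (A.inl x) (A.inr y) := by
  have : Commute (MonoidHom.inl G₁ G₂ x) (MonoidHom.inr G₁ G₂ y) := MonoidHom.commute_inl_inr x y
  exact this.map (QuotientGroup.mk' A.kernel)

theorem exists_inl_mul_inr (z : A.Product) : ∃ x y, A.inl x * A.inr y = z := by
  obtain ⟨⟨x, y⟩, rfl⟩ := QuotientGroup.mk_surjective z
  refine ⟨x, y, ?_⟩
  change QuotientGroup.mk' A.kernel _ * QuotientGroup.mk' A.kernel _ = QuotientGroup.mk' A.kernel _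
  rw [← map_mul]
  simp

end CentralAmalgam

theorem IsNonabelianCommutatorAmalgam.not_comm {G : Type u} [Group G]
    (h : IsNonabelianCommutatorAmalgam G) : ¬ ∀ x y : G, x * y = y * x := by
  obtain ⟨G₁, G₂, _, _, A, h1, -, -, -, -, -, ⟨e⟩⟩ := h
  intro hc
  refine h1 fun x y => A.inl_injective (e.symm.injective ?_)
  simp only [map_mul]
  exact hc _ _

/-- A central product with nontrivial amalgamation inside both derived subgroups is not capable. -/
theorem IsNonabelianCommutatorAmalgam.not_isCapable {G : Type u} [Group G]
    (h : IsNonabelianCommutatorAmalgam G) : ¬ IsCapable G := by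
  obtain ⟨G₁, G₂, _, _, A, -, -, -, hne, hle1, hle2, ⟨e⟩⟩ := h
  rintro ⟨K, _, ⟨e'⟩⟩
  let π : K →* A.Product :=
    (e'.symm.trans e).toMonoidHom.comp (QuotientGroup.mk' (Subgroup.center K))
  have hπ : Function.Surjective π :=
    (e'.symm.trans e).surjective.comp (QuotientGroup.mk'_surjective _)
  have hker : ∀ k, π k = 1 → k ∈ Subgroup.center K := by
    intro k hk
    rw [← QuotientGroup.eq_one_iff]
    exact (map_eq_one_iff _ (e'.symm.trans e).injective).1 hk
  have hker' : ∀ k ∈ Subgroup.center K, π k = 1 := by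
    intro k hk
    have : QuotientGroup.mk' (Subgroup.center K) k = 1 := (QuotientGroup.eq_one_iff k).2 hk
    simp only [π, MonoidHom.comp_apply, this, map_one]
  let N₁ := A.inl.range.comap π
  let N₂ := A.inr.range.comap π
  have hcen : ∀ a ∈ N₁, ∀ b ∈ N₂, ⁅a, b⁆ ∈ Subgroup.center K := by
    rintro a ⟨x, hx⟩ b ⟨y, hy⟩
    apply hker
    rw [map_commutatorElement, ← hx, ← hy, commutatorElement_eq_one_iff_commute]
    exact A.commute_inl_inr x y
  have h12 : ⁅N₁, N₂⁆ ≤ Subgroup.center K := Subgroup.commutator_le.2 hcen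
  have hbot : ∀ N M : Subgroup K, N ≤ Subgroup.center K → ⁅N, M⁆ = ⊥ := by
    intro N M hN
    rw [Subgroup.commutator_eq_bot_iff_le_centralizer]
    exact hN.trans (Subgroup.center_le_centralizer _)
  -- Three subgroups lemma: the other two double commutators vanish since `⁅N₁, N₂⁆` is central.
  have hA : ⁅⁅N₁, N₁⁆, N₂⁆ = ⊥ := Subgroup.commutator_commutator_eq_bot_of_rotate
    (hbot _ _ h12) (hbot _ _ (by rwa [Subgroup.commutator_comm]))
  have hB : ⁅⁅N₂, N₂⁆, N₁⁆ = ⊥ := Subgroup.commutator_commutator_eq_bot_of_rotate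
    (hbot _ _ (by rwa [Subgroup.commutator_comm])) (hbot _ _ h12)
  obtain ⟨h, hh1⟩ := Subgroup.ne_bot_iff_exists_ne_one.1 hne
  have lift : ∀ {G' : Type u} [Group G'] (ψ : G' →* A.Product) (g : G'), g ∈ commutator G' →
      ∃ k ∈ ⁅ψ.range.comap π, ψ.range.comap π⁆, π k = ψ g := by
    intro G' _ ψ g hg
    have h1 : ψ g ∈ (commutator G').map ψ := Subgroup.mem_map_of_mem ψ hg
    rwa [commutator_def, Subgroup.map_commutator, ← MonoidHom.range_eq_map,
      ← Subgroup.map_comap_eq_self_of_surjective hπ ψ.range, ← Subgroup.map_commutator] at h1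
  obtain ⟨k₁, hk₁, e₁⟩ := lift A.inl h.1 (hle1 h.2)
  obtain ⟨k₂, hk₂, e₂⟩ := lift A.inr (A.φ h) (hle2 ⟨h, rfl⟩)
  have hc1 : ∀ n ∈ N₂, n * k₁ = k₁ * n := fun n hn => Subgroup.mem_centralizer_iff.1
    (Subgroup.commutator_eq_bot_iff_le_centralizer.1 hA hk₁) n hn
  have hc2 : ∀ n ∈ N₁, n * k₂ = k₂ * n := fun n hn => Subgroup.mem_centralizer_iff.1
    (Subgroup.commutator_eq_bot_iff_le_centralizer.1 hB hk₂) n hn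
  -- Both are lifts of the same amalgamated element. Since `k₁` centralizes `N₂` and `k₂`
  -- centralizes `N₁`, each centralizes both.
  have hz : k₂⁻¹ * k₁ ∈ Subgroup.center K := by
    apply hker
    rw [map_mul, map_inv, e₁, e₂, A.inl_eq_inr, inv_mul_cancel]
  have hc3 : ∀ n ∈ N₁, n * k₁ = k₁ * n := by
    intro n hn
    have h1 : Commute n (k₂ * (k₂⁻¹ * k₁)) :=
      Commute.mul_right (hc2 n hn) (Subgroup.mem_center_iff.1 hz n)
    rwa [mul_inv_cancel_left] at h1
  have hk : k₁ ∈ Subgroup.center K := by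
    rw [Subgroup.mem_center_iff]
    intro k
    obtain ⟨x, y, hxy⟩ := A.exists_inl_mul_inr (π k)
    obtain ⟨n₁, hn₁⟩ := hπ (A.inl x)
    obtain ⟨n₂, hn₂⟩ := hπ (A.inr y)
    have hw : (n₁ * n₂)⁻¹ * k ∈ Subgroup.center K := by
      apply hker
      rw [map_mul, map_inv, map_mul, hn₁, hn₂, hxy, inv_mul_cancel]
    have h1 : Commute (n₁ * n₂ * ((n₁ * n₂)⁻¹ * k)) k₁ :=
      Commute.mul_left (Commute.mul_left (hc3 n₁ ⟨x, hn₁.symm⟩) (hc1 n₂ ⟨y, hn₂.symm⟩))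
        (Subgroup.mem_center_iff.1 hw k₁).symm
    rwa [mul_inv_cancel_left] at h1
  have h1 : A.inl h.1 = 1 := by rw [← e₁, hker' k₁ hk]
  exact hh1 (Subtype.ext ((injective_iff_map_eq_one _).1 A.inl_injective _ h1))

/-! ### Recognizing an internal central product. -/

section Amalgam

theorem commutator_map_subtype {G : Type*} [Group G] (A : Subgroup G) :
    (commutator A).map A.subtype = ⁅A, A⁆ := by
  rw [commutator_def, Subgroup.map_commutator, ← MonoidHom.range_eq_map, Subgroup.range_subtype]

/-- An internal central product over a cyclic group lying in both derived subgroups. -/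
theorem isNonabelianCommutatorAmalgam_of_subgroups {G : Type u} [Group G] (A B : Subgroup G)
    (hcomm : ∀ a ∈ A, ∀ b ∈ B, a * b = b * a) (hcov : ∀ g, ∃ a ∈ A, ∃ b ∈ B, a * b = g)
    {c : G} (hc : c ≠ 1) (hAB : A ⊓ B = Subgroup.zpowers c) (hcA : c ∈ ⁅A, A⁆)
    (hcB : c ∈ ⁅B, B⁆) : IsNonabelianCommutatorAmalgam G := by
  have nonab : ∀ D : Subgroup G, c ∈ ⁅D, D⁆ → ¬ ∀ x y : D, x * y = y * x := by
    intro D hD h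
    have : ⁅D, D⁆ = ⊥ := by
      rw [Subgroup.commutator_eq_bot_iff_le_centralizer]
      intro x hx
      rw [Subgroup.mem_centralizer_iff]
      intro y hy
      exact congrArg Subtype.val (h ⟨y, hy⟩ ⟨x, hx⟩)
    rw [this] at hD
    exact hc hD
  have hcAB : c ∈ A ⊓ B := hAB ▸ Subgroup.mem_zpowers c
  let H : Subgroup A := (A ⊓ B).subgroupOf A
  let φ : H →* B :=
    { toFun := fun h => ⟨h.1.1, h.2.2⟩
      map_one' := rfl
      map_mul' := fun _ _ => rfl }
  let M : CentralAmalgam A B :=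
    { H := H
      H_le_center := fun h hh => Subgroup.mem_center_iff.2 fun a =>
        Subtype.ext (hcomm a.1 a.2 h.1 hh.2)
      φ := φ
      φ_injective := fun h h' e =>
        Subtype.ext (Subtype.ext (congrArg (fun b : B => b.1) e))
      φ_mem_center := fun h => Subgroup.mem_center_iff.2 fun b =>
        Subtype.ext (hcomm h.1.1 h.1.2 b.1 b.2).symm }
  let μ : A × B →* G := MonoidHom.noncommCoprod A.subtype B.subtype
    (fun a b => hcomm a.1 a.2 b.1 b.2)
  have hμ : Function.Surjective μ := by
    intro g
    obtain ⟨a, ha, b, hb, rfl⟩ := hcov g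
    exact ⟨(⟨a, ha⟩, ⟨b, hb⟩), rfl⟩
  have hker : μ.ker = M.kernel := by
    ext ⟨a, b⟩
    constructor
    · intro h
      have h' : a.1 * b.1 = 1 := h
      have hab : a.1 = b.1⁻¹ := eq_inv_of_mul_eq_one_left h'
      have haB : a.1 ∈ B := by
        rw [hab]
        exact inv_mem b.2
      refine ⟨⟨a, a.2, haB⟩, Prod.ext rfl (Subtype.ext ?_)⟩
      change b.1 = a.1⁻¹
      rw [hab, inv_inv]
    · rintro ⟨h, hh⟩
      rw [hh]
      change h.1.1 * (h.1.1)⁻¹ = 1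
      simp
  refine ⟨A, B, inferInstance, inferInstance, M, nonab A hcA, nonab B hcB, ?_, ?_, ?_, ?_,
    ⟨((QuotientGroup.quotientMulEquivOfEq hker).symm.trans
      (QuotientGroup.quotientKerEquivOfSurjective μ hμ)).symm⟩⟩
  · let ι : H →* Subgroup.zpowers c :=
      { toFun := fun h => ⟨h.1.1, hAB ▸ h.2⟩
        map_one' := rfl
        map_mul' := fun _ _ => rfl }
    exact isCyclic_of_injective ι fun h h' e =>
      Subtype.ext (Subtype.ext (congrArg (fun z : Subgroup.zpowers c => z.1) e))
  · intro h
    have : (⟨c, hcAB.1⟩ : A) ∈ (⊥ : Subgroup A) := h ▸ (show (⟨c, hcAB.1⟩ : A) ∈ H from hcAB)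
    exact hc (congrArg Subtype.val (Subgroup.mem_bot.1 this))
  · rintro h hh
    have h1 : h.1 ∈ Subgroup.zpowers c := hAB ▸ hh
    have h2 : h.1 ∈ (commutator A).map A.subtype := by
      rw [commutator_map_subtype]
      exact Subgroup.zpowers_le.2 hcA h1
    obtain ⟨x, hx, hxh⟩ := h2
    rwa [← Subtype.ext (a1 := x) (a2 := h) hxh]
  · rintro _ ⟨h, rfl⟩
    have h1 : h.1.1 ∈ Subgroup.zpowers c := hAB ▸ h.2
    have h2 : h.1.1 ∈ (commutator B).map B.subtype := by
      rw [commutator_map_subtype]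
      exact Subgroup.zpowers_le.2 hcB h1
    obtain ⟨x, hx, hxh⟩ := h2
    have h3 : M.φ h = x := Subtype.ext hxh.symm
    rwa [h3]

end Amalgam

/-! ### Commutator calculus in class two and the Baer addition. -/

section ClassTwo

variable {G : Type u} [Group G]

/-- In a group of class two, `b ↦ ⁅a, b⁆` is a homomorphism. -/
def commutatorHom (hz : ∀ g h : G, ⁅g, h⁆ ∈ Subgroup.center G) (a : G) : G →* G where
  toFun b := ⁅a, b⁆
  map_one' := by simp
  map_mul' b c := by
    have h := Subgroup.mem_center_iff.1 (hz a c) b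
    calc ⁅a, b * c⁆ = ⁅a, b⁆ * (b * ⁅a, c⁆ * b⁻¹) := by simp only [commutatorElement_def]; group
      _ = ⁅a, b⁆ * ⁅a, c⁆ := by rw [h, mul_inv_cancel_right]

theorem commutator_mul_right (hz : ∀ g h : G, ⁅g, h⁆ ∈ Subgroup.center G)
    (a b c : G) : ⁅a, b * c⁆ = ⁅a, b⁆ * ⁅a, c⁆ :=
  map_mul (commutatorHom hz a) b c

theorem commutator_mul_left (hz : ∀ g h : G, ⁅g, h⁆ ∈ Subgroup.center G)
    (a b c : G) : ⁅a * b, c⁆ = ⁅a, c⁆ * ⁅b, c⁆ := by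
  rw [← commutatorElement_inv, commutator_mul_right hz, mul_inv_rev, commutatorElement_inv,
    commutatorElement_inv]
  exact (Subgroup.mem_center_iff.1 (hz a c) _)

theorem commutator_zpow_right (hz : ∀ g h : G, ⁅g, h⁆ ∈ Subgroup.center G)
    (a b : G) (n : ℤ) : ⁅a, b ^ n⁆ = ⁅a, b⁆ ^ n :=
  map_zpow (commutatorHom hz a) b n

theorem commutator_inv_right (hz : ∀ g h : G, ⁅g, h⁆ ∈ Subgroup.center G)
    (a b : G) : ⁅a, b⁻¹⁆ = ⁅a, b⁆⁻¹ :=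
  map_inv (commutatorHom hz a) b

theorem commutator_center_right (a : G) {z : G} (h : z ∈ Subgroup.center G) : ⁅a, z⁆ = 1 :=
  commutatorElement_eq_one_iff_mul_comm.2 (Subgroup.mem_center_iff.1 h a)

theorem commutator_center_left (a : G) {z : G} (h : z ∈ Subgroup.center G) : ⁅z, a⁆ = 1 :=
  commutatorElement_eq_one_iff_mul_comm.2 (Subgroup.mem_center_iff.1 h a).symm

/-- Two noncommuting elements whose commutators are powers of a single `c`, with `c` a product of
commutators of elements centralizing both, split off a factor of a central product. -/
theorem isNonabelianCommutatorAmalgam_of_pair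
    (hz : ∀ g h : G, ⁅g, h⁆ ∈ Subgroup.center G)
    {p : ℕ} (hp : p.Prime) (hexp : ∀ g : G, g ^ p = 1)
    {x₁ x₂ c : G} (hc : ⁅x₁, x₂⁆ = c) (hc1 : c ≠ 1)
    (h₁ : ∀ g, ⁅x₁, g⁆ ∈ Subgroup.zpowers c) (h₂ : ∀ g, ⁅x₂, g⁆ ∈ Subgroup.zpowers c)
    (hcB : c ∈ ⁅Subgroup.centralizer {x₁, x₂}, Subgroup.centralizer {x₁, x₂}⁆) :
    IsNonabelianCommutatorAmalgam G := by
  have hcz : c ∈ Subgroup.center G := hc ▸ hz x₁ x₂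
  have hc' : ⁅x₂, x₁⁆ = c⁻¹ := by rw [← hc, commutatorElement_inv]
  have memB : ∀ g, g ∈ Subgroup.centralizer {x₁, x₂} ↔ ⁅x₁, g⁆ = 1 ∧ ⁅x₂, g⁆ = 1 := by
    intro g
    simp [Subgroup.mem_centralizer_iff, commutatorElement_eq_one_iff_mul_comm]
  have hx₁ : x₁ ∈ Subgroup.closure {x₁, x₂} := Subgroup.subset_closure (by simp)
  have hx₂ : x₂ ∈ Subgroup.closure {x₁, x₂} := Subgroup.subset_closure (by simp)
  have hcA : c ∈ ⁅Subgroup.closure {x₁, x₂}, Subgroup.closure {x₁, x₂}⁆ :=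
    hc ▸ Subgroup.commutator_mem_commutator hx₁ hx₂
  have : Fact p.Prime := ⟨hp⟩
  have hord : orderOf c = p := orderOf_eq_prime (hexp c) hc1
  refine isNonabelianCommutatorAmalgam_of_subgroups (Subgroup.closure {x₁, x₂})
    (Subgroup.centralizer {x₁, x₂}) ?_ ?_ hc1 ?_ hcA hcB
  · intro a ha b hb
    have hle : Subgroup.closure {x₁, x₂} ≤ Subgroup.centralizer {b} := by
      rw [Subgroup.closure_le]
      intro x hx
      exact Subgroup.mem_centralizer_iff.2 fun y hy => by
        rw [Set.mem_singleton_iff.1 hy]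
        exact (Subgroup.mem_centralizer_iff.1 hb x hx).symm
    exact (Subgroup.mem_centralizer_iff.1 (hle ha) b rfl).symm
  · intro g
    obtain ⟨n, hn⟩ := h₁ g
    obtain ⟨m, hm⟩ := h₂ g
    simp only at hn hm
    -- Orthogonal projection: this product has the same commutators with `x₁` and `x₂` as `g`, so
    -- the quotient centralizes both.
    refine ⟨x₁ ^ (-m) * x₂ ^ n, mul_mem (zpow_mem hx₁ _) (zpow_mem hx₂ _),
      (x₁ ^ (-m) * x₂ ^ n)⁻¹ * g, (memB _).2 ⟨?_, ?_⟩, mul_inv_cancel_left _ _⟩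
    · simp only [commutator_mul_right hz, commutator_inv_right hz, commutator_zpow_right hz, hc,
        commutatorElement_self, one_zpow, one_mul]
      rw [← hn, inv_mul_cancel]
    · simp only [commutator_mul_right hz, commutator_inv_right hz, commutator_zpow_right hz, hc',
        commutatorElement_self, one_zpow, mul_one]
      rw [← hm]
      simp
  · apply le_antisymm
    · rintro a ⟨ha, hb⟩
      have hform : ∃ i j k : ℤ, a = x₁ ^ i * x₂ ^ j * c ^ k := by
        clear hb
        have hcomm : ∀ (k : ℤ) g, g * c ^ k = c ^ k * g := fun k =>
          Subgroup.mem_center_iff.1 (zpow_mem hcz k)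
        have hswap : ∀ i j : ℤ, x₂ ^ j * x₁ ^ i = x₁ ^ i * x₂ ^ j * c ^ (-(j * i)) := by
          intro i j
          have h1 : ⁅x₂ ^ j, x₁ ^ i⁆ = c ^ (-(j * i)) := by
            rw [commutator_zpow_right hz, ← commutatorElement_inv, commutator_zpow_right hz, hc,
              ← zpow_neg, ← zpow_mul, neg_mul]
          rw [hcomm, ← h1, commutatorElement_def]
          group
        induction ha using Subgroup.closure_induction with
        | mem x hx =>
          rcases hx with rfl | rfl
          · exact ⟨1, 0, 0, by simp⟩
          · exact ⟨0, 1, 0, by simp⟩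
        | one => exact ⟨0, 0, 0, by simp⟩
        | mul x y _ _ hx hy =>
          obtain ⟨i, j, k, rfl⟩ := hx
          obtain ⟨i', j', k', rfl⟩ := hy
          refine ⟨i + i', j + j', -(j * i') + k + k', ?_⟩
          calc x₁ ^ i * x₂ ^ j * c ^ k * (x₁ ^ i' * x₂ ^ j' * c ^ k')
              = x₁ ^ i * x₂ ^ j * (x₁ ^ i' * x₂ ^ j') * c ^ k * c ^ k' := by
                rw [← mul_assoc, mul_assoc (x₁ ^ i * x₂ ^ j), ← hcomm]; group
            _ = x₁ ^ i * (x₂ ^ j * x₁ ^ i') * x₂ ^ j' * c ^ k * c ^ k' := by group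
            _ = x₁ ^ i * (x₁ ^ i' * x₂ ^ j * (c ^ (-(j * i')) * x₂ ^ j')) * c ^ k * c ^ k' := by
                rw [hswap]; group
            _ = x₁ ^ (i + i') * x₂ ^ (j + j') * c ^ (-(j * i') + k + k') := by
                rw [← hcomm]; group
        | inv x _ hx =>
          obtain ⟨i, j, k, rfl⟩ := hx
          refine ⟨-i, -j, -(j * i) - k, ?_⟩
          calc (x₁ ^ i * x₂ ^ j * c ^ k)⁻¹ = c ^ (-k) * (x₂ ^ (-j) * x₁ ^ (-i)) := by group
            _ = x₁ ^ (-i) * x₂ ^ (-j) * c ^ (-(j * i) - k) := by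
                rw [hswap, ← hcomm, neg_mul_neg]; group
      obtain ⟨i, j, k, rfl⟩ := hform
      have hb' := (memB _).1 hb
      simp only [commutator_mul_right hz, commutator_zpow_right hz, hc, hc',
        commutatorElement_self, commutator_center_right _ hcz, one_zpow, mul_one, one_mul,
        inv_zpow', zpow_neg, inv_eq_one] at hb'
      -- Commuting with `x₁` and `x₂` gives `c ^ j = c ^ i = 1`. As `c` has order `p`, the exponent
      -- hypothesis removes both factors and leaves a power of `c`.
      have hpow : ∀ (n : ℤ) (x : G), c ^ n = 1 → x ^ n = 1 := by
        intro n x hn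
        rw [← orderOf_dvd_iff_zpow_eq_one, hord] at hn
        obtain ⟨m, rfl⟩ := hn
        rw [zpow_mul, zpow_natCast, hexp, one_zpow]
      rw [hpow i x₁ hb'.2, hpow j x₂ hb'.1, one_mul, one_mul]
      exact Subgroup.zpow_mem_zpowers c k
    · rw [Subgroup.zpowers_le]
      refine ⟨hc ▸ ?_, Subgroup.center_le_centralizer _ hcz⟩
      change ⁅x₁, x₂⁆ ∈ Subgroup.closure {x₁, x₂}
      rw [commutatorElement_def]
      exact mul_mem (mul_mem (mul_mem hx₁ hx₂) (inv_mem hx₁)) (inv_mem hx₂)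

/-- The addition `x + y = x y ⁅y, x⁆^h` on a group of class two and exponent `2 h - 1`. -/
@[reducible] def baerAddCommGroup
    (hz : ∀ g h : G, ⁅g, h⁆ ∈ Subgroup.center G)
    (h : ℕ) (hh : ∀ g : G, g ^ (2 * h) = g) : AddCommGroup G where
  add x y := x * y * ⁅y, x⁆ ^ h
  zero := 1
  neg x := x⁻¹
  nsmul := @nsmulRec G ⟨1⟩ ⟨fun x y => x * y * ⁅y, x⁆ ^ h⟩
  zsmul := @zsmulRec G ⟨1⟩ ⟨fun x y => x * y * ⁅y, x⁆ ^ h⟩ ⟨fun x => x⁻¹⟩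
    (@nsmulRec G ⟨1⟩ ⟨fun x y => x * y * ⁅y, x⁆ ^ h⟩)
  add_assoc x y z := by
    change x * y * ⁅y, x⁆ ^ h * z * ⁅z, x * y * ⁅y, x⁆ ^ h⁆ ^ h =
      x * (y * z * ⁅z, y⁆ ^ h) * ⁅y * z * ⁅z, y⁆ ^ h, x⁆ ^ h
    have hc : ∀ a b, ⁅a, b⁆ ^ h ∈ Subgroup.center G := fun a b => pow_mem (hz a b) h
    have hmv : ∀ a b g, g * ⁅a, b⁆ ^ h = ⁅a, b⁆ ^ h * g := fun a b =>
      Subgroup.mem_center_iff.1 (hc a b)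
    have hmp : ∀ a b c d : G, (⁅a, b⁆ * ⁅c, d⁆) ^ h = ⁅a, b⁆ ^ h * ⁅c, d⁆ ^ h := fun a b c d =>
      Commute.mul_pow (Subgroup.mem_center_iff.1 (hz c d) _) h
    rw [commutator_mul_right hz, commutator_mul_right hz, commutator_center_right _ (hc y x),
      commutator_mul_left hz, commutator_mul_left hz, commutator_center_left _ (hc z y), mul_one,
      mul_one, hmp, hmp]
    calc x * y * ⁅y, x⁆ ^ h * z * (⁅z, x⁆ ^ h * ⁅z, y⁆ ^ h)
        = x * y * (z * ⁅y, x⁆ ^ h) * (⁅z, x⁆ ^ h * ⁅z, y⁆ ^ h) := by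
          rw [hmv y x z]; simp only [mul_assoc]
      _ = x * y * z * ((⁅y, x⁆ ^ h * ⁅z, x⁆ ^ h) * ⁅z, y⁆ ^ h) := by simp only [mul_assoc]
      _ = x * (y * z * ⁅z, y⁆ ^ h) * (⁅y, x⁆ ^ h * ⁅z, x⁆ ^ h) := by
          rw [hmv z y (⁅y, x⁆ ^ h * ⁅z, x⁆ ^ h)]; simp only [mul_assoc]
  zero_add x := by
    change 1 * x * ⁅x, 1⁆ ^ h = x
    simp
  add_zero x := by
    change x * 1 * ⁅1, x⁆ ^ h = x
    simp
  neg_add_cancel x := by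
    change x⁻¹ * x * ⁅x, x⁻¹⁆ ^ h = 1
    simp [commutatorElement_def]
  add_comm x y := by
    change x * y * ⁅y, x⁆ ^ h = y * x * ⁅x, y⁆ ^ h
    have h1 : x * y = y * x * ⁅x, y⁆ := by
      rw [Subgroup.mem_center_iff.1 (hz x y), commutatorElement_def]; group
    have h2 : ⁅x, y⁆ * ⁅y, x⁆ ^ h = ⁅x, y⁆ ^ h := by
      rw [← commutatorElement_inv x y, inv_pow, mul_inv_eq_iff_eq_mul, ← pow_add, ← two_mul, hh]
    rw [h1, mul_assoc, h2]

theorem baer_nsmul (hz : ∀ g h : G, ⁅g, h⁆ ∈ Subgroup.center G) (h : ℕ)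
    (hh : ∀ g : G, g ^ (2 * h) = g) (n : ℕ) (x : G) :
    letI := baerAddCommGroup hz h hh
    n • x = x ^ n := by
  let := baerAddCommGroup hz h hh
  induction n with
  | zero => rw [zero_nsmul, pow_zero]; rfl
  | succ n ih =>
    rw [succ_nsmul, ih]
    change x ^ n * x * ⁅x, x ^ n⁆ ^ h = _
    have : ⁅x, x ^ n⁆ = 1 := commutatorElement_eq_one_iff_commute.2 (Commute.self_pow x n)
    rw [this, one_pow, mul_one, pow_succ]

end ClassTwo

/-! ### Linear coordinates on groups of odd exponent. -/

section Coordinates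

/-- `P` and `q` identify `G` with `W × D`, multiplied by
`(w, d) (w', d') = (w + w', d + d' + b w w' / 2)`. -/
structure IsCoordinates {G F W D : Type*} [Group G] [Field F] [AddCommGroup W] [Module F W]
    [AddCommGroup D] [Module F D] (b : W →ₗ[F] W →ₗ[F] D) (P : G → W) (q : G → D) : Prop where
  alt : ∀ w, b w w = 0
  P_mul : ∀ g h, P (g * h) = P g + P h
  q_mul : ∀ g h, q (g * h) = q g + q h + (2⁻¹ : F) • b (P g) (P h)
  inj : ∀ g h, P g = P h → q g = q h → g = h
  surj : ∀ w d, ∃ g, P g = w ∧ q g = d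

/-- The Baer correspondence: a group of class two and odd prime exponent `p` carries the structure
of a Lie algebra over `ZMod p`. -/
theorem exists_baer {G : Type u} [Group G] {p : ℕ} [Fact p.Prime] (h2 : (2 : ZMod p) ≠ 0)
    (hz : ∀ g h : G, ⁅g, h⁆ ∈ Subgroup.center G) (hexp : ∀ g : G, g ^ p = 1) :
    ∃ (L : Type u) (_ : AddCommGroup L) (_ : Module (ZMod p) L) (e : G ≃ L) (B : L → L → L),
      (∀ g h, e (g * h) = e g + e h + (2⁻¹ : ZMod p) • B (e g) (e h)) ∧
      (∀ x, B x x = 0) ∧ (∀ x y z, B x (B y z) = 0) ∧ (∀ x y z, B (B y z) x = 0) ∧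
      (∀ x y z, B (x + y) z = B x z + B y z) ∧ (∀ x y z, B x (y + z) = B x y + B x z) := by
  -- The integer `h` represents one half modulo `p`.
  obtain ⟨h, hp⟩ : ∃ h, p + 1 = 2 * h := by
    rcases (Fact.out : p.Prime).eq_two_or_odd' with rfl | ⟨k, hk⟩
    · exact absurd (CharTwo.two_eq_zero (R := ZMod 2)) h2
    · exact ⟨k + 1, by omega⟩
  have hh : ∀ g : G, g ^ (2 * h) = g := fun g => by rw [← hp, pow_succ, hexp, one_mul]
  have h2h : (2⁻¹ : ZMod p) = (h : ZMod p) := by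
    have : ((p + 1 : ℕ) : ZMod p) = ((2 * h : ℕ) : ZMod p) := by rw [hp]
    push_cast at this
    rw [CharP.cast_eq_zero, zero_add] at this
    exact inv_eq_of_mul_eq_one_right this.symm
  let iA : AddCommGroup G := baerAddCommGroup hz h hh
  let iM : Module (ZMod p) G := AddCommGroup.zmodModule (n := p) fun x => by
    rw [baer_nsmul hz h hh, hexp]; rfl
  have hadd : ∀ x y : G, x + y = x * y * ⁅y, x⁆ ^ h := fun _ _ => rfl
  refine ⟨G, iA, iM, Equiv.refl G, fun x y => ⁅x, y⁆, ?_, fun x => commutatorElement_self x,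
    fun x y z => commutator_center_right _ (hz y z), fun x y z => commutator_center_left _ (hz y z),
    ?_, ?_⟩
  · intro x y
    simp only [Equiv.refl_apply]
    rw [h2h, Nat.cast_smul_eq_nsmul, baer_nsmul hz h hh, hadd x y, hadd,
      commutator_center_left _ (pow_mem (hz x y) h), one_pow, mul_one, ← commutatorElement_inv x y,
      inv_pow, inv_mul_cancel_right]
  · intro x y a
    simp only
    rw [hadd x y, commutator_mul_left hz, commutator_mul_left hz,
      commutator_center_left _ (pow_mem (hz y x) h), mul_one, hadd ⁅x, a⁆,
      commutator_center_left _ (hz y a), one_pow, mul_one]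
  · intro x y a
    simp only
    rw [hadd y a, commutator_mul_right hz, commutator_mul_right hz,
      commutator_center_right _ (pow_mem (hz a y) h), mul_one, hadd ⁅x, y⁆,
      commutator_center_left _ (hz x a), one_pow, mul_one]

/-- Groups of class two and odd prime exponent are given by alternating bilinear maps. -/
theorem exists_coordinates {G : Type u} [Group G] {p : ℕ} [Fact p.Prime] (h2 : (2 : ZMod p) ≠ 0)
    (hz : ∀ g h : G, ⁅g, h⁆ ∈ Subgroup.center G) (hexp : ∀ g : G, g ^ p = 1) :
    ∃ (W D : Type u) (_ : AddCommGroup W) (_ : Module (ZMod p) W) (_ : AddCommGroup D)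
      (_ : Module (ZMod p) D) (b : W →ₗ[ZMod p] W →ₗ[ZMod p] D) (P : G → W) (q : G → D),
      IsCoordinates b P q := by
  obtain ⟨L, _, _, e, B, hmul, hself, hBr, hBl, hl, hr⟩ := exists_baer h2 hz hexp
  let br : L →ₗ[ZMod p] L →ₗ[ZMod p] L := AddMonoidHom.toZModLinearMap p
    (AddMonoidHom.mk' (fun x => AddMonoidHom.toZModLinearMap p
      (AddMonoidHom.mk' (fun y => B x y) (hr x))) fun x y => LinearMap.ext fun a => hl x y a)
  have hbr : ∀ x y, br x y = B x y := fun _ _ => rfl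
  simp only [← hbr] at hmul hself hBr hBl
  clear_value br
  -- The derived subalgebra is central, so the bracket is determined on any complement `W`.
  let D : Submodule (ZMod p) L := Submodule.span _ {d | ∃ u v, br u v = d}
  have hbrD : ∀ u v, br u v ∈ D := fun u v => Submodule.subset_span ⟨u, v, rfl⟩
  obtain ⟨W, hW⟩ := D.exists_isCompl
  have hDr : ∀ u, ∀ d ∈ D, br u d = 0 := by
    intro u d hd
    have : D ≤ LinearMap.ker (br u) := by
      rw [Submodule.span_le]
      rintro _ ⟨v, w, rfl⟩
      exact hBr u v w
    exact this hd
  have hDl : ∀ u, ∀ d ∈ D, br d u = 0 := by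
    intro u d hd
    rw [bilin_swap br hself, hDr u d hd, neg_zero]
  let P : L →ₗ[ZMod p] W := W.projectionOnto D hW.symm
  let q : L →ₗ[ZMod p] D := D.projectionOnto W hW
  have hPD : ∀ d ∈ D, P d = 0 := fun d hd => Submodule.projectionOnto_apply_of_mem_right hW.symm hd
  have hqD : ∀ d (hd : d ∈ D), q d = ⟨d, hd⟩ := fun d hd =>
    Submodule.projectionOnto_apply_of_mem_left hW hd
  have hPW : ∀ w : W, P w = w := Submodule.projectionOnto_apply_left hW.symm
  have hqW : ∀ w : W, q w = 0 := Submodule.projectionOnto_apply_right hW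
  have hsum : ∀ x, (q x : L) + (P x : L) = x := fun x => by
    rw [Submodule.coe_projectionOnto_apply, Submodule.coe_projectionOnto_apply,
      Submodule.projection_add_projection_eq_self]
  have hbrP : ∀ x y, br (P x) (P y) = br x y := by
    intro x y
    conv_rhs => rw [← hsum x, ← hsum y]
    simp [hDl _ _ (q x).2, hDr _ _ (q y).2]
  let b : W →ₗ[ZMod p] W →ₗ[ZMod p] D := LinearMap.mk₂ _ (fun u v => ⟨br u v, hbrD u v⟩)
    (fun _ _ _ => Subtype.ext (by simp)) (fun _ _ _ => Subtype.ext (by simp))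
    (fun _ _ _ => Subtype.ext (by simp)) (fun _ _ _ => Subtype.ext (by simp))
  refine ⟨W, D, inferInstance, inferInstance, inferInstance, inferInstance, b, fun g => P (e g),
    fun g => q (e g), fun w => Subtype.ext (hself w), ?_, ?_, ?_, ?_⟩
  · intro g h
    simp only [hmul, map_add, map_smul, hPD _ (hbrD _ _), smul_zero, add_zero]
  · intro g h
    simp only [hmul, map_add, map_smul, hqD _ (hbrD _ _)]
    congr 2
    exact Subtype.ext (hbrP _ _).symm
  · intro g h h1 h2
    apply e.injective
    rw [← hsum (e g), ← hsum (e h)]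
    rw [h1, h2]
  · intro w d
    refine ⟨e.symm (d + w), ?_, ?_⟩
    · simp [hPW, hPD d d.2]
    · simp [hqW, hqD d d.2]

end Coordinates

/-! ### Lifting double brackets to the tensor cube. -/

section Cocycle

variable {F W : Type*} [Field F] [AddCommGroup W] [Module F W]

/-- A trilinear map satisfying the symmetries of a double bracket is the double bracket in the
tensor algebra evaluated on a suitable trilinear form. -/
theorem exists_tensor_lift [FiniteDimensional F W] (S : W →ₗ[F] W →ₗ[F] W →ₗ[F] F)
    (halt : ∀ u w, S u u w = 0) (hjac : ∀ u v w, S u v w + S v w u + S w u v = 0) :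
    ∃ τ : W →ₗ[F] W →ₗ[F] W →ₗ[F] F, ∀ u v w,
      τ u v w - τ v u w - τ w u v + τ w v u = S u v w := by
  have hsw : ∀ u v w, S u v w = - S v u w := by
    intro u v w
    rw [bilin_swap S (fun v => LinearMap.ext (halt v)), LinearMap.neg_apply]
  let β := Module.finBasis F W
  -- Taking `τ = S / 3` would do, but not in characteristic three. A table supported on words whose
  -- first letter is minimal avoids the division.
  let t : Fin (Module.finrank F W) → Fin (Module.finrank F W) → Fin (Module.finrank F W) → F :=
    fun i j k => if i < j ∧ i < k then S (β i) (β j) (β k)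
      else if i = j ∧ i < k then S (β k) (β i) (β i) else 0
  let τ : W →ₗ[F] W →ₗ[F] W →ₗ[F] F :=
    β.constr F fun i => β.constr F fun j => β.constr F fun k => t i j k
  have hτ : ∀ i j k, τ (β i) (β j) (β k) = t i j k := by
    intro i j k
    simp [τ]
  have t1 : ∀ {i j k}, i < j → i < k → t i j k = S (β i) (β j) (β k) := fun h h' =>
    if_pos ⟨h, h'⟩
  have t2 : ∀ {i k}, i < k → t i i k = S (β k) (β i) (β i) := fun {i k} h => by simp [t, h]
  have t3 : ∀ {i j k}, j < i → t i j k = 0 := fun {i j k} h => by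
    simp [t, h.ne', h.not_gt]
  have t4 : ∀ {i j k}, k ≤ i → t i j k = 0 := fun {i j k} h => by
    simp [t, h.not_gt]
  have hbasis : ∀ i j k, t i j k - t j i k - t k i j + t k j i = S (β i) (β j) (β k) := by
    intro i j k
    have h1 := hjac (β i) (β j) (β k)
    have h3 := hsw (β i) (β j) (β k)
    have h4 := hsw (β j) (β k) (β i)
    rcases lt_trichotomy i j with hij | rfl | hij
    · rcases lt_trichotomy i k with hik | rfl | hik
      · rw [t1 hij hik, t3 hij, t3 hik, t4 hik.le]; ring
      · rw [t4 le_rfl, t3 hij, t2 hij]; linear_combination -h3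
      · rw [t4 hik.le, t3 hij, t1 hik (hik.trans hij), t1 (hik.trans hij) hik]
        linear_combination -h1 + h4
    · rw [halt]; ring
    · rcases lt_trichotomy j k with hjk | rfl | hjk
      · rw [t3 hij, t1 hij hjk, t4 hjk.le, t3 hjk]; linear_combination -h3
      · rw [t3 hij, t4 le_rfl, t2 hij]; ring
      · rw [t3 hij, t4 hjk.le, t1 (hjk.trans hij) hjk, t1 hjk (hjk.trans hij)]
        linear_combination -h1 + h4
  refine ⟨τ, fun u v w => ?_⟩
  have hu := β.mem_span u
  induction hu using Submodule.span_induction with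
  | mem _ hu =>
    obtain ⟨i, rfl⟩ := hu
    have hv := β.mem_span v
    induction hv using Submodule.span_induction with
    | mem _ hv =>
      obtain ⟨j, rfl⟩ := hv
      have hw := β.mem_span w
      induction hw using Submodule.span_induction with
      | mem _ hw =>
        obtain ⟨k, rfl⟩ := hw
        rw [hτ, hτ, hτ, hτ, hbasis]
      | zero => simp
      | add x y _ _ hx hy =>
        simp only [map_add, LinearMap.add_apply]
        linear_combination hx + hy
      | smul a x _ hx =>
        simp only [map_smul, LinearMap.smul_apply, smul_eq_mul]
        linear_combination a * hx
    | zero => simp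
    | add x y _ _ hx hy =>
      simp only [map_add, LinearMap.add_apply]
      linear_combination hx + hy
    | smul a x _ hx =>
      simp only [map_smul, LinearMap.smul_apply, smul_eq_mul]
      linear_combination a * hx
  | zero => simp
  | add x y _ _ hx hy =>
    simp only [map_add, LinearMap.add_apply]
    linear_combination hx + hy
  | smul a x _ hx =>
    simp only [map_smul, LinearMap.smul_apply, smul_eq_mul]
    linear_combination a * hx

end Cocycle

/-! ### Central extensions detecting elements inside and outside the derived subgroup. -/

section Extensions

variable {G : Type u} [Group G] {F : Type} {W D : Type*} [Field F] [AddCommGroup W] [Module F W]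
  [AddCommGroup D] [Module F D] {b : W →ₗ[F] W →ₗ[F] D} {P : G → W} {q : G → D}

theorem IsCoordinates.P_one (hC : IsCoordinates b P q) : P 1 = 0 := by
  have := hC.P_mul 1 1
  rwa [mul_one, left_eq_add] at this

theorem IsCoordinates.q_one (hC : IsCoordinates b P q) : q 1 = 0 := by
  have := hC.q_mul 1 1
  rwa [mul_one, hC.P_one, map_zero, smul_zero, add_zero, left_eq_add] at this

theorem IsCoordinates.P_commutator (hC : IsCoordinates b P q) (g h : G) : P ⁅g, h⁆ = 0 := by
  have h1 : ⁅g, h⁆ * (h * g) = g * h := by rw [commutatorElement_def]; group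
  have h3 := congrArg P h1
  simp only [hC.P_mul] at h3
  rwa [add_comm (P h), add_eq_right] at h3

theorem IsCoordinates.q_commutator (hC : IsCoordinates b P q) (h2 : (2 : F) ≠ 0) (g h : G) :
    q ⁅g, h⁆ = b (P g) (P h) := by
  have h1 : ⁅g, h⁆ * (h * g) = g * h := by rw [commutatorElement_def]; group
  have h3 := congrArg q h1
  rw [hC.q_mul, hC.P_commutator, map_zero, LinearMap.zero_apply, smul_zero, add_zero, hC.q_mul,
    hC.q_mul, bilin_swap b hC.alt (P h), smul_neg] at h3
  have h4 : q ⁅g, h⁆ = (2⁻¹ : F) • b (P g) (P h) + (2⁻¹ : F) • b (P g) (P h) := by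
    rw [← sub_eq_zero] at h3 ⊢
    rw [← h3]
    abel
  rw [h4, ← add_smul, ← two_mul, mul_inv_cancel₀ h2, one_smul]

theorem IsCoordinates.commutator_eq (hC : IsCoordinates b P q) (h2 : (2 : F) ≠ 0) {g h z : G}
    (hz : P z = 0) (hb : b (P g) (P h) = q z) : ⁅g, h⁆ = z :=
  hC.inj _ _ (by rw [hC.P_commutator, hz]) (by rw [hC.q_commutator h2, hb])

theorem IsCoordinates.pow (hC : IsCoordinates b P q) {g : G} (hg : P g = 0) (n : ℕ) :
    P (g ^ n) = 0 ∧ q (g ^ n) = (n : F) • q g := by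
  induction n with
  | zero => simp [hC.P_one, hC.q_one]
  | succ n ih =>
    rw [pow_succ, hC.P_mul, hC.q_mul, ih.1, ih.2, hg]
    simp [add_smul]

/-- A solution of the Jacobi identity not vanishing at `q g` yields a central extension in which
no lift of `g` is central. -/
theorem exists_extension_of_jacobi [FiniteDimensional F W]
    (hC : IsCoordinates b P q) (T : D →ₗ[F] W →ₗ[F] F) (hT : IsJacobi b T) {g : G} (hg : P g = 0)
    (hTg : T (q g) ≠ 0) :
    ∃ (E : Type u) (_ : Group E) (π : E →* G), Function.Surjective π ∧
      π.ker ≤ Subgroup.center E ∧ ∀ x, π x = g → x ∉ Subgroup.center E := by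
  obtain ⟨τ, hτ⟩ := exists_tensor_lift (b.compr₂ T) (fun u w => by simp [hC.alt]) hT
  simp only [LinearMap.compr₂_apply] at hτ
  obtain ⟨y, hy⟩ : ∃ y, T (q g) y ≠ 0 := by
    by_contra! h
    exact hTg (LinearMap.ext h)
  obtain ⟨h, hh, -⟩ := hC.surj y 0
  -- The term `T (q x) (P y)` fails the cocycle identity by half of `T (b (P x) (P y)) (P z)`; the
  -- `τ` terms cancel this. They vanish when `P x` or `P y` is zero, so `g` is detected by `T (q g)`
  -- alone.
  refine exists_extension_of_cocycle (fun x y => T (q x) (P y) + 2⁻¹ * (τ (P x) (P y) (P y) +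
    τ (P x) (P y) (P x) - τ (P y) (P x) (P y) + τ (P y) (P y) (P x))) ?_ ?_ (g := g) (h := h) ?_
  · intro x
    simp [hC.P_one, hC.q_one]
  · intro x y z
    simp only [hC.P_mul, hC.q_mul, map_add, map_smul, LinearMap.add_apply, LinearMap.smul_apply,
      smul_eq_mul]
    linear_combination (-2⁻¹ : F) * hτ (P x) (P y) (P z)
  · intro _
    simp [hg, hh, hy]

/-- Elements outside the derived subgroup are detected by bilinear cocycles. -/
theorem exists_extension_of_notMem_commutator {p : ℕ} [Fact p.Prime]
    (hz : ∀ g h : G, ⁅g, h⁆ ∈ Subgroup.center G) (hexp : ∀ g : G, g ^ p = 1)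
    (hcyc : ¬ IsCyclic G) {g : G} (hg : g ∉ commutator G) :
    ∃ (E : Type u) (_ : Group E) (π : E →* G), Function.Surjective π ∧
      π.ker ≤ Subgroup.center E ∧ ∀ x, π x = g → x ∉ Subgroup.center E := by
  have hsurj : Function.Surjective (Abelianization.of (G := G)) :=
    QuotientGroup.mk'_surjective (commutator G)
  have iM : Module (ZMod p) (Additive (Abelianization G)) :=
    AddCommGroup.zmodModule (n := p) fun x => by
      obtain ⟨y, hy⟩ := hsurj x.toMul
      rw [← ofMul_toMul x, ← hy, ← ofMul_pow, ← map_pow, hexp, map_one, ofMul_one]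
  let v : G → Additive (Abelianization G) := fun x => Additive.ofMul (Abelianization.of x)
  have hv : ∀ x y, v (x * y) = v x + v y := fun x y => by simp [v]
  have hg0 : v g ≠ 0 := by
    intro h
    apply hg
    rw [← Abelianization.ker_of]
    exact h
  -- Otherwise the abelianization is cyclic with central kernel, so `G` is abelian and itself
  -- cyclic.
  obtain ⟨h, hh⟩ : ∃ h, v h ∉ Submodule.span (ZMod p) {v g} := by
    by_contra! hall
    have hker : (Abelianization.of (G := G)).ker ≤ Subgroup.center G := by
      rw [Abelianization.ker_of, commutator_def, Subgroup.commutator_le]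
      exact fun g _ h _ => hz g h
    have hc : IsCyclic (Abelianization G) := by
      refine ⟨Abelianization.of g, fun x => ?_⟩
      obtain ⟨y, rfl⟩ := hsurj x
      obtain ⟨k, hk⟩ := Submodule.mem_span_singleton.1 (hall y)
      refine ⟨(k.val : ℤ), ?_⟩
      rw [← ZMod.natCast_zmod_val k, Nat.cast_smul_eq_nsmul] at hk
      simp only [zpow_natCast]
      exact hk
    have hcomm := MonoidHom.isMulCommutative_of_isCyclic_of_ker_le_center _ hker
    have hbot : (Abelianization.of (G := G)).ker = ⊥ := by
      rw [Abelianization.ker_of, eq_bot_iff, commutator_def, Subgroup.commutator_le]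
      exact fun a _ b _ => commutatorElement_eq_one_iff_mul_comm.2 (mul_comm' a b)
    exact hcyc (isCyclic_of_injective _ ((MonoidHom.ker_eq_bot_iff _).1 hbot))
  obtain ⟨y, hy1, hy2⟩ := exists_dual_eq_one hh
  obtain ⟨x, hx, -⟩ := exists_dual_eq_one (F := ZMod p) (c := v g) (D := ⊥) (by simpa using hg0)
  refine exists_extension_of_cocycle (fun a c => x (v a) * y (v c)) ?_ ?_ (g := g) (h := h) ?_
  · intro a
    have : v 1 = 0 := by simp [v]
    simp [this]
  · intro a c d
    simp only [hv, map_add]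
    ring
  · intro _
    simp [hx, hy1, hy2 _ (Submodule.mem_span_singleton_self _)]

end Extensions

theorem commutator_mem_center_of_class_two {G : Type u} [Group G]
    (hclass : Subgroup.lowerCentralSeries (⊤ : Subgroup G) 2 = ⊥) (g h : G) :
    ⁅g, h⁆ ∈ Subgroup.center G := by
  rw [Subgroup.lowerCentralSeries_succ, Subgroup.top_lowerCentralSeries_one,
    Subgroup.commutator_eq_bot_iff_le_centralizer, Subgroup.coe_top,
    Subgroup.centralizer_univ] at hclass
  exact hclass (Subgroup.commutator_mem_commutator (Subgroup.mem_top g) (Subgroup.mem_top h))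

/-! ### Translating the linear algebra back to the group. -/

section

variable {G : Type u} [Group G] {p : ℕ} [Fact p.Prime] {W D : Type*} [AddCommGroup W]
  [Module (ZMod p) W] [AddCommGroup D] [Module (ZMod p) D] {b : W →ₗ[ZMod p] W →ₗ[ZMod p] D}
  {P : G → W} {q : G → D}

theorem IsCoordinates.span_range_eq_top (hC : IsCoordinates b P q) {ι : Type*} {s : ι → G}
    (hs : Subgroup.closure (Set.range s) = ⊤) :
    Submodule.span (ZMod p) (Set.range (P ∘ s)) = ⊤ := by
  rw [eq_top_iff]
  rintro w -
  obtain ⟨g, rfl, -⟩ := hC.surj w 0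
  have hg : g ∈ Subgroup.closure (Set.range s) := hs ▸ Subgroup.mem_top g
  induction hg using Subgroup.closure_induction with
  | mem x hx =>
    obtain ⟨i, rfl⟩ := hx
    exact Submodule.subset_span ⟨i, rfl⟩
  | one => rw [hC.P_one]; exact Submodule.zero_mem _
  | mul x y _ _ hx hy => rw [hC.P_mul]; exact Submodule.add_mem _ hx hy
  | inv x _ hx =>
    have h1 : P x⁻¹ = - P x := by
      rw [eq_neg_iff_add_eq_zero, ← hC.P_mul, inv_mul_cancel, hC.P_one]
    rw [h1]
    exact Submodule.neg_mem _ hx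

theorem IsCoordinates.mem_commutator (hC : IsCoordinates b P q) (h2 : (2 : ZMod p) ≠ 0) {g : G}
    (hg : g ∈ commutator G) :
    P g = 0 ∧ q g ∈ Submodule.span (ZMod p) {d | ∃ u v, b u v = d} := by
  rw [commutator_eq_closure] at hg
  induction hg using Subgroup.closure_induction with
  | mem x hx =>
    obtain ⟨y, z, rfl⟩ := hx
    refine ⟨hC.P_commutator y z, ?_⟩
    rw [hC.q_commutator h2]
    exact Submodule.subset_span ⟨_, _, rfl⟩
  | one => exact ⟨hC.P_one, by rw [hC.q_one]; exact Submodule.zero_mem _⟩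
  | mul x y _ _ hx hy =>
    refine ⟨by rw [hC.P_mul, hx.1, hy.1, add_zero], ?_⟩
    rw [hC.q_mul, hx.1, map_zero, LinearMap.zero_apply, smul_zero, add_zero]
    exact Submodule.add_mem _ hx.2 hy.2
  | inv x _ hx =>
    have h1 : P x⁻¹ = 0 := by
      have := hC.P_mul x⁻¹ x
      rwa [inv_mul_cancel, hC.P_one, hx.1, add_zero, eq_comm] at this
    have h3 : q x⁻¹ = - q x := by
      have := hC.q_mul x⁻¹ x
      rw [inv_mul_cancel, hC.q_one, h1, map_zero, LinearMap.zero_apply, smul_zero, add_zero] at this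
      exact eq_neg_of_add_eq_zero_left this.symm
    exact ⟨h1, by rw [h3]; exact Submodule.neg_mem _ hx.2⟩

/-- On `P = 0` the map `q` is an additive bijection onto `D`, and scalars of `ZMod p` act as powers,
so linear spans become subgroup membership. -/
theorem IsCoordinates.mem_of_mem_span (hC : IsCoordinates b P q) (A : Subgroup G) {X : Set D}
    (hX : ∀ g, P g = 0 → q g ∈ X → g ∈ A) {g : G} (hP : P g = 0)
    (hg : q g ∈ Submodule.span (ZMod p) X) : g ∈ A := by
  generalize hd : q g = d at hg
  induction hg using Submodule.span_induction generalizing g with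
  | mem d hd' => exact hX g hP (hd ▸ hd')
  | zero =>
    rw [hC.inj g 1 (by rw [hP, hC.P_one]) (by rw [hd, hC.q_one])]
    exact one_mem A
  | add x y _ _ hx hy =>
    obtain ⟨g₁, hP₁, hq₁⟩ := hC.surj 0 x
    obtain ⟨g₂, hP₂, hq₂⟩ := hC.surj 0 y
    have : g = g₁ * g₂ := hC.inj _ _ (by rw [hP, hC.P_mul, hP₁, hP₂, add_zero])
      (by rw [hd, hC.q_mul, hq₁, hq₂, hP₁, map_zero, LinearMap.zero_apply, smul_zero, add_zero])
    rw [this]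
    exact mul_mem (hx hP₁ hq₁) (hy hP₂ hq₂)
  | smul k x _ hx =>
    obtain ⟨g₁, hP₁, hq₁⟩ := hC.surj 0 x
    have hpow := hC.pow hP₁ k.val
    have : g = g₁ ^ k.val := hC.inj _ _ (by rw [hP, hpow.1])
      (by rw [hd, hpow.2, hq₁, ZMod.natCast_zmod_val])
    rw [this]
    exact pow_mem (hx hP₁ hq₁) _

/-- If no solution of the Jacobi identity detects `q g`, the group is a central product. -/
theorem IsCoordinates.isNonabelianCommutatorAmalgam (hC : IsCoordinates b P q)
    (h2 : (2 : ZMod p) ≠ 0) (hz : ∀ g h : G, ⁅g, h⁆ ∈ Subgroup.center G)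
    (hexp : ∀ g : G, g ^ p = 1) [FiniteDimensional (ZMod p) W]
    (hdim : Module.finrank (ZMod p) W ≤ 5) {g : G} (hg1 : g ≠ 1) (hgc : g ∈ commutator G)
    (hbad : ∀ T, IsJacobi b T → T (q g) = 0) : IsNonabelianCommutatorAmalgam G := by
  obtain ⟨hP, hspan⟩ := hC.mem_commutator h2 hgc
  have hq : q g ≠ 0 := fun h => hg1 (hC.inj _ _ (by rw [hP, hC.P_one]) (by rw [h, hC.q_one]))
  obtain ⟨v₁, v₂, h12, h₁, h₂, hc⟩ := exists_hyperbolic_pair h2 hdim b hC.alt hq hspan hbad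
  obtain ⟨x₁, rfl, -⟩ := hC.surj v₁ 0
  obtain ⟨x₂, rfl, -⟩ := hC.surj v₂ 0
  have hpow : ∀ x, (∀ u, b (P x) u ∈ Submodule.span (ZMod p) {q g}) →
      ∀ h, ⁅x, h⁆ ∈ Subgroup.zpowers g := by
    intro x hx h
    refine hC.mem_of_mem_span _ (X := {q g}) ?_ (hC.P_commutator x h) ?_
    · intro g' hP' hq'
      rw [hC.inj g' g (by rw [hP', hP]) hq']
      exact Subgroup.mem_zpowers g
    · rw [hC.q_commutator h2]
      exact hx _
  refine isNonabelianCommutatorAmalgam_of_pair hz Fact.out hexp (hC.commutator_eq h2 hP h12) hg1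
    (hpow x₁ h₁) (hpow x₂ h₂) (hC.mem_of_mem_span _ ?_ hP hc)
  rintro g' hP' ⟨u, v, hu₁, hu₂, hv₁, hv₂, huv⟩
  obtain ⟨y, rfl, -⟩ := hC.surj u 0
  obtain ⟨z, rfl, -⟩ := hC.surj v 0
  have hcent : ∀ y, b (P x₁) (P y) = 0 → b (P x₂) (P y) = 0 →
      y ∈ Subgroup.centralizer {x₁, x₂} := by
    intro y hy₁ hy₂
    rw [Subgroup.mem_centralizer_iff]
    rintro x (rfl | rfl)
    · exact commutatorElement_eq_one_iff_mul_comm.1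
        (hC.commutator_eq h2 hC.P_one (by rw [hy₁, hC.q_one]))
    · exact commutatorElement_eq_one_iff_mul_comm.1
        (hC.commutator_eq h2 hC.P_one (by rw [hy₂, hC.q_one]))
  rw [← hC.commutator_eq h2 hP' huv]
  exact Subgroup.commutator_mem_commutator (hcent y hu₁ hu₂) (hcent z hv₁ hv₂)

end

theorem mainTheorem5 {G : Type u} [Group G] (p : ℕ) (hp : p.Prime)
    (hgen : ∃ g : Fin 5 → G, Subgroup.closure (Set.range g) = ⊤)
    (hclass : Subgroup.lowerCentralSeries (⊤ : Subgroup G) 2 = ⊥)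
    (hexp : ∀ g : G, g ^ p = 1) :
    ((IsCyclic G ∧ Nontrivial G) ∨ IsNonabelianCommutatorAmalgam G ∨ IsCapable G) ∧
    ¬ ((IsCyclic G ∧ Nontrivial G) ∧ IsNonabelianCommutatorAmalgam G) ∧
    ¬ ((IsCyclic G ∧ Nontrivial G) ∧ IsCapable G) ∧
    ¬ (IsNonabelianCommutatorAmalgam G ∧ IsCapable G) := by
  have : Fact p.Prime := ⟨hp⟩
  have hz := commutator_mem_center_of_class_two hclass
  refine ⟨?_, ?_, ?_, ?_⟩
  · by_cases hcyc : IsCyclic G ∧ Nontrivial G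
    · exact Or.inl hcyc
    refine Or.inr ((em (IsCapable G)).symm.imp_left fun hcap => ?_)
    -- An element no central extension detects. The trivial group has none, so its being cyclic
    -- causes no conflict.
    obtain ⟨g, hg1, hg⟩ := not_forall₂.1 (mt isCapable_of_extensions hcap)
    have hncyc : ¬ IsCyclic G := fun h => hcyc ⟨h, ⟨g, 1, hg1⟩⟩
    have hgc : g ∈ commutator G := by
      by_contra h
      exact hg (exists_extension_of_notMem_commutator hz hexp hncyc h)
    -- Exponent two makes `G` abelian, contradicting `1 ≠ g ∈ [G,G]`.
    have h2 : (2 : ZMod p) ≠ 0 := by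
      intro h
      have hp2 : p = 2 := (Nat.prime_dvd_prime_iff_eq hp Nat.prime_two).1
        ((ZMod.natCast_eq_zero_iff 2 p).1 (by exact_mod_cast h))
      subst hp2
      have hinv : ∀ x : G, x⁻¹ = x := fun x => inv_eq_of_mul_eq_one_right (by rw [← sq, hexp])
      have hcomm : ∀ x y : G, x * y = y * x := fun x y => by
        rw [← hinv (x * y), mul_inv_rev, hinv, hinv]
      have hbot : commutator G ≤ ⊥ := by
        rw [commutator_def, Subgroup.commutator_le]
        exact fun a _ c _ => commutatorElement_eq_one_iff_mul_comm.2 (hcomm a c)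
      exact hg1 (hbot hgc)
    obtain ⟨W, D, _, _, _, _, b, P, q, hC⟩ := exists_coordinates h2 hz hexp
    obtain ⟨s, hs⟩ := hgen
    have hspan := hC.span_range_eq_top hs
    have hfin : FiniteDimensional (ZMod p) W :=
      ⟨⟨(Set.finite_range (P ∘ s)).toFinset, by simpa using hspan⟩⟩
    have hdim : Module.finrank (ZMod p) W ≤ 5 := by
      rw [← finrank_top, ← hspan]
      simpa [Set.finrank] using finrank_range_le_card (R := ZMod p) (P ∘ s)
    refine hC.isNonabelianCommutatorAmalgam h2 hz hexp hdim hg1 hgc fun T hT => ?_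
    by_contra hTg
    exact hg (exists_extension_of_jacobi hC T hT (hC.mem_commutator h2 hgc).1 hTg)
  · rintro ⟨⟨hc, -⟩, ha⟩
    let := IsCyclic.commGroup (α := G)
    exact ha.not_comm fun x y => mul_comm x y
  · rintro ⟨⟨hc, hn⟩, hcap⟩
    exact not_isCapable_of_isCyclic hcap
  · rintro ⟨ha, hcap⟩
    exact ha.not_isCapable hcap
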